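/- Let $a_1,a_2,a_3\in\mathbb R$, let $F,\beta:\mathbb R^3\to(0,\infty)$ and $f:\mathbb R^2\to(0,\infty)$ be smooth, and put $G=F\beta$. Let $\varphi:\mathbb R^2\to\mathbb R^3$, $\varphi(x,y)=(x,y,a_1x+a_2y+a_3)$, let $h_0=F^{-2}(dx^2+dy^2+dz^2)$ and $h=\beta^{-2}h_0$ on $\mathbb R^3$, and consider the map $\varphi:(\mathbb R^2,f^{-1}\varphi^*h)\to(\mathbb R^3,h)$. For a map $\varphi:(M,g)\to(N,h)$ of Riemannian manifolds with tension field $\tau(\varphi)=\operatorname{Trace}_g\nabla d\varphi$, call $\varphi$ proper biharmonic if $\tau(\varphi)\not\equiv0$ and $$\tau_2(\varphi)=\operatorname{Trace}_g(\nabla^\varphi\nabla^\varphi-\nabla^\varphi_{\nabla^M})\tau(\varphi)-\operatorname{Trace}_gR^N(d\varphi,\tau(\varphi))d\varphi\equiv0,$$ where $R^N(X,Y)Z=[\nabla^N_X,\nabla^N_Y]Z-\nabla^N_{[X,Y]}Z$. Then $\varphi:(\mathbb R^2,f^{-1}\varphi^*h)\to(\mathbb R^3,h)$ is proper biharmonic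 if and only if both of the following hold: (1) at every point of the plane $z=a_1x+a_2y+a_3$, $$\begin{aligned} &\tfrac{1+2a_1^2+a_2^2}{1+a_1^2+a_2^2}\,[GG_{xx}-2G_x^2]+\tfrac{1+a_1^2+2a_2^2}{1+a_1^2+a_2^2}\,[GG_{yy}-2G_y^2]+\tfrac{2+a_1^2+a_2^2}{1+a_1^2+a_2^2}\,[GG_{zz}-2G_z^2]\\ &+\tfrac{2a_1a_2}{1+a_1^2+a_2^2}\,[GG_{xy}-2G_xG_y]-\tfrac{2a_1}{1+a_1^2+a_2^2}\,[GG_{xz}-2G_xG_z]-\tfrac{2a_2}{1+a_1^2+a_2^2}\,[GG_{yz}-2G_yG_z]=0; \end{aligned}$$ (2) $-a_1G_x-a_2G_y+G_z$ vanishes nowhere on this plane, and for some constant $c>0$ $$f=\frac{c\,\sqrt{1+a_1^2+a_2^2}}{|-a_1G_x-a_2G_y+G_z|}\circ\varphi .$$ Furthermore, without assuming biharmonicity, $\varphi:(\mathbb R^2,f^{-1}\varphi^*h)\to(\mathbb R^3,h)$ is a conformal immersion with conformal factor $\lambda=f^{1/2}$ (that is, $\varphi^*h=\lambda^2\,f^{-1}\varphi^*h$),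 the field $\xi=\frac{G\circ\varphi}{\sqrt{1+a_1^2+a_2^2}}\,(-a_1,-a_2,1)$ is a unit normal of the surface in $(\mathbb R^3,h)$, and the surface $(\mathbb R^2,\varphi^*h)$ has mean curvature vector field $H\xi$ with $$H=\frac{-a_1G_x-a_2G_y+G_z}{\sqrt{1+a_1^2+a_2^2}}\circ\varphi .$$ -/

import Mathlib

open scoped ContDiff

/-! Riemannian geometry in the global coordinates of `ℝⁿ`, modelled as `Fin n → ℝ`.  A (Riemannian)
metric on `ℝⁿ` is given by the matrix field `g x i j = g(∂ᵢ, ∂ⱼ)(x)`, and a vector field along a map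
`φ : ℝᵐ → ℝⁿ` is given by its components, as a map `ℝᵐ → ℝⁿ`. -/

namespace CoordGeom

noncomputable section

/-- The partial derivative `∂ᵢ f` of a real function on `ℝⁿ`. -/
def pd {n : ℕ} (i : Fin n) (f : (Fin n → ℝ) → ℝ) (x : Fin n → ℝ) : ℝ :=
  fderiv ℝ f x (Pi.single i 1)

/-- A field of matrices on `ℝⁿ`, thought of as a field of bilinear forms. -/
abbrev MetricField (n : ℕ) : Type := (Fin n → ℝ) → Matrix (Fin n) (Fin n) ℝ

/-- The field `g` is a smooth Riemannian metric on `ℝⁿ`. -/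
def IsRiemannianMetric {n : ℕ} (g : MetricField n) : Prop :=
  (∀ i j, ContDiff ℝ ∞ (fun x => g x i j)) ∧ ∀ x, (g x).PosDef

/-- The standard flat metric of `ℝⁿ`. -/
def euclideanMetric (n : ℕ) : MetricField n := fun _ => 1

/-- The pointwise rescaling `u g` of the metric `g` by the function `u`. -/
def rescale {n : ℕ} (u : (Fin n → ℝ) → ℝ) (g : MetricField n) : MetricField n :=
  fun x => u x • g x

/-- The inner product `g_x(v, w)`. -/
def metricInner {n : ℕ} (g : MetricField n) (x v w : Fin n → ℝ) : ℝ :=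
  ∑ i, ∑ j, g x i j * v i * w j

/-- The Christoffel symbol `Γᵏᵢⱼ` of the Levi-Civita connection of `g`. -/
def christoffel {n : ℕ} (g : MetricField n) (k i j : Fin n) (x : Fin n → ℝ) : ℝ :=
  (1 / 2) * ∑ l, (g x)⁻¹ k l *
    (pd i (fun y => g y j l) x + pd j (fun y => g y i l) x - pd l (fun y => g y i j) x)

/-- The component `Rˡ` of `R(∂ᵢ, ∂ⱼ)∂ₖ = Rˡ ∂ₗ`, for the curvature operator
`R(X, Y)Z = ∇_X ∇_Y Z - ∇_Y ∇_X Z - ∇_[X, Y] Z` of `g`. -/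
def curvature {n : ℕ} (g : MetricField n) (i j k l : Fin n) (x : Fin n → ℝ) : ℝ :=
  pd i (christoffel g l j k) x - pd j (christoffel g l i k) x
    + ∑ s, (christoffel g s j k x * christoffel g l i s x
      - christoffel g s i k x * christoffel g l j s x)

/-- The curvature operator `R(X, Y)Z` of `g` at the point `x`. -/
def curvatureOp {n : ℕ} (g : MetricField n) (x X Y Z : Fin n → ℝ) : Fin n → ℝ :=
  fun l => ∑ i, ∑ j, ∑ k, X i * Y j * Z k * curvature g i j k l x

/-- The vector field `dφ(∂ᵢ)` along `φ`. -/
def dmap {m n : ℕ} (φ : (Fin m → ℝ) → (Fin n → ℝ)) (i : Fin m) (x : Fin m → ℝ) : Fin n → ℝ :=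
  fun α => pd i (fun y => φ y α) x

/-- The covariant derivative `∇^φ_{∂ᵢ} V` of a vector field `V` along `φ : ℝᵐ → (ℝⁿ, h)`, for the
connection on `φ⁻¹ T ℝⁿ` pulled back from the Levi-Civita connection of `h`. -/
def covDeriv {m n : ℕ} (h : MetricField n) (φ : (Fin m → ℝ) → (Fin n → ℝ)) (i : Fin m)
    (V : (Fin m → ℝ) → (Fin n → ℝ)) (x : Fin m → ℝ) : Fin n → ℝ :=
  fun α => pd i (fun y => V y α) x
    + ∑ b, ∑ c, christoffel h α b c (φ x) * dmap φ i x b * V x c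

/-- The second fundamental form `(∇dφ)(∂ᵢ, ∂ⱼ)` of a map `φ : (ℝᵐ, g) → (ℝⁿ, h)`. -/
def secondFundForm {m n : ℕ} (g : MetricField m) (h : MetricField n)
    (φ : (Fin m → ℝ) → (Fin n → ℝ)) (i j : Fin m) (x : Fin m → ℝ) : Fin n → ℝ :=
  covDeriv h φ i (dmap φ j) x - ∑ k, christoffel g k i j x • dmap φ k x

/-- The tension field `τ(φ) = Trace_g ∇dφ` of a map `φ : (ℝᵐ, g) → (ℝⁿ, h)`. -/
def tension {m n : ℕ} (g : MetricField m) (h : MetricField n)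
    (φ : (Fin m → ℝ) → (Fin n → ℝ)) (x : Fin m → ℝ) : Fin n → ℝ :=
  ∑ i, ∑ j, (g x)⁻¹ i j • secondFundForm g h φ i j x

/-- The bitension field
`τ₂(φ) = Trace_g (∇^φ ∇^φ - ∇^φ_{∇^M}) τ(φ) - Trace_g R^N(dφ, τ(φ)) dφ`
of a map `φ : (ℝᵐ, g) → (ℝⁿ, h)`. -/
def bitension {m n : ℕ} (g : MetricField m) (h : MetricField n)
    (φ : (Fin m → ℝ) → (Fin n → ℝ)) (x : Fin m → ℝ) : Fin n → ℝ :=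
  (∑ i, ∑ j, (g x)⁻¹ i j •
    (covDeriv h φ i (covDeriv h φ j (tension g h φ)) x
      - ∑ k, christoffel g k i j x • covDeriv h φ k (tension g h φ) x))
  - ∑ i, ∑ j, (g x)⁻¹ i j •
      curvatureOp h (φ x) (dmap φ i x) (tension g h φ x) (dmap φ j x)

/-- The map `φ : (ℝᵐ, g) → (ℝⁿ, h)` is harmonic. -/
def IsHarmonicMap {m n : ℕ} (g : MetricField m) (h : MetricField n)
    (φ : (Fin m → ℝ) → (Fin n → ℝ)) : Prop :=
  ∀ x, tension g h φ x = 0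

/-- The map `φ : (ℝᵐ, g) → (ℝⁿ, h)` is biharmonic. -/
def IsBiharmonicMap {m n : ℕ} (g : MetricField m) (h : MetricField n)
    (φ : (Fin m → ℝ) → (Fin n → ℝ)) : Prop :=
  ∀ x, bitension g h φ x = 0

/-- The map `φ : (ℝᵐ, g) → (ℝⁿ, h)` is proper biharmonic: biharmonic and not harmonic. -/
def IsProperBiharmonicMap {m n : ℕ} (g : MetricField m) (h : MetricField n)
    (φ : (Fin m → ℝ) → (Fin n → ℝ)) : Prop :=
  IsBiharmonicMap g h φ ∧ ¬ IsHarmonicMap g h φ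

/-- The pullback `φ*h` of the metric `h`. -/
def pullback {m n : ℕ} (φ : (Fin m → ℝ) → (Fin n → ℝ)) (h : MetricField n) : MetricField m :=
  fun x => Matrix.of fun i j => metricInner h (φ x) (dmap φ i x) (dmap φ j x)

/-- The map `φ : (ℝᵐ, g) → (ℝⁿ, h)` between Riemannian manifolds is a conformal immersion with
conformal factor `μ > 0`, that is, a smooth immersion with `φ*h = μ² g`. -/
def IsConformalImmersion {m n : ℕ} (g : MetricField m) (h : MetricField n)
    (φ : (Fin m → ℝ) → (Fin n → ℝ)) (μ : (Fin m → ℝ) → ℝ) : Prop :=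
  IsRiemannianMetric g ∧ IsRiemannianMetric h ∧ ContDiff ℝ ∞ φ ∧
    (∀ x, Function.Injective (fderiv ℝ φ x)) ∧ (∀ x, 0 < μ x) ∧
    pullback φ h = rescale (fun x => μ x ^ 2) g

/-- The field `ξ` along `φ : ℝᵐ → (ℝⁿ, h)` is a smooth unit normal vector field. -/
def IsUnitNormal {m n : ℕ} (h : MetricField n) (φ : (Fin m → ℝ) → (Fin n → ℝ))
    (ξ : (Fin m → ℝ) → (Fin n → ℝ)) : Prop :=
  ContDiff ℝ ∞ ξ ∧ ∀ x, metricInner h (φ x) (ξ x) (ξ x) = 1 ∧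
    ∀ i, metricInner h (φ x) (ξ x) (dmap φ i x) = 0

/-- The mean curvature vector field `η = (1/m) Trace_g ∇dφ` of the isometric immersion
`φ : (ℝᵐ, g = φ*h) → (ℝⁿ, h)`. -/
def meanCurvatureVector {m n : ℕ} (h : MetricField n) (φ : (Fin m → ℝ) → (Fin n → ℝ))
    (x : Fin m → ℝ) : Fin n → ℝ :=
  (1 / (m : ℝ)) • tension (pullback φ h) h φ x

/-- The mean curvature `H = h(η, ξ)` with respect to the unit normal field `ξ`. -/
def meanCurvature {m n : ℕ} (h : MetricField n) (φ : (Fin m → ℝ) → (Fin n → ℝ))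
    (ξ : (Fin m → ℝ) → (Fin n → ℝ)) (x : Fin m → ℝ) : ℝ :=
  metricInner h (φ x) (meanCurvatureVector h φ x) (ξ x)

/-- The parametrized plane `(x, y) ↦ (x, y, a₁ x + a₂ y + a₃)`. -/
def planeMap (a₁ a₂ a₃ : ℝ) (p : Fin 2 → ℝ) : Fin 3 → ℝ :=
  ![p 0, p 1, a₁ * p 0 + a₂ * p 1 + a₃]

/-- The left-hand side of the second-order equation, at the point `q`, for a function `G` of the
coordinates `(x, y, z) = (q 0, q 1, q 2)`. -/
def planeOperator (a₁ a₂ : ℝ) (G : (Fin 3 → ℝ) → ℝ) (q : Fin 3 → ℝ) : ℝ :=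
  (1 + 2 * a₁ ^ 2 + a₂ ^ 2) / (1 + a₁ ^ 2 + a₂ ^ 2)
      * (G q * pd 0 (pd 0 G) q - 2 * pd 0 G q ^ 2)
    + (1 + a₁ ^ 2 + 2 * a₂ ^ 2) / (1 + a₁ ^ 2 + a₂ ^ 2)
      * (G q * pd 1 (pd 1 G) q - 2 * pd 1 G q ^ 2)
    + (2 + a₁ ^ 2 + a₂ ^ 2) / (1 + a₁ ^ 2 + a₂ ^ 2)
      * (G q * pd 2 (pd 2 G) q - 2 * pd 2 G q ^ 2)
    + 2 * a₁ * a₂ / (1 + a₁ ^ 2 + a₂ ^ 2)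
      * (G q * pd 1 (pd 0 G) q - 2 * pd 0 G q * pd 1 G q)
    - 2 * a₁ / (1 + a₁ ^ 2 + a₂ ^ 2)
      * (G q * pd 2 (pd 0 G) q - 2 * pd 0 G q * pd 2 G q)
    - 2 * a₂ / (1 + a₁ ^ 2 + a₂ ^ 2)
      * (G q * pd 2 (pd 1 G) q - 2 * pd 1 G q * pd 2 G q)

/-- The derivative `-a₁ G_x - a₂ G_y + G_z` of `G` in the direction `(-a₁, -a₂, 1)`. -/
def normalDeriv (a₁ a₂ : ℝ) (G : (Fin 3 → ℝ) → ℝ) (q : Fin 3 → ℝ) : ℝ :=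
  -a₁ * pd 0 G q - a₂ * pd 1 G q + pd 2 G q

end

end CoordGeom

/-! Write `φ` for the parametrized plane, `N` for a Euclidean normal vector and `ν = dG(N)`, and let
`ρ = (f G²)⁻¹`, so that the metric on `ℝ²` is `ρ` times a constant one. In dimension two the trace
of the Christoffel symbols of such a metric vanishes, so that traces of second derivatives are only
rescaled by `ρ⁻¹`. Hence `τ(φ) = G u N` with `u = 2 f ν / |N|²`, and applying the Jacobi operator
yields `τ₂(φ) = ρ⁻¹ ((G Δu + u Q / G) N - 2 ν ∇u)`, where `Δ` and `∇` are the Laplacian and the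
gradient of the flat plane and `Q` depends only on `G` and the direction of `N`. As `ν` is a
positive multiple of `u / f`, the tangential part vanishes if and only if `u²` is constant, which
for `u ≠ 0` is the formula for `f`. Then `∇u = 0` and `Δu = 0`, so that the normal part reduces to
`Q = 0`. -/

namespace CoordGeom

open scoped Matrix

noncomputable section

section Calculus

variable {m n : ℕ}

/-- The Euclidean gradient of a real function on `ℝⁿ`. -/
def grad (f : (Fin n → ℝ) → ℝ) (x : Fin n → ℝ) : Fin n → ℝ := fun i => pd i f x

/-- The Hessian matrix `(∂ᵢ ∂ⱼ f)` of a real function on `ℝⁿ`. -/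
def hess (f : (Fin n → ℝ) → ℝ) (x : Fin n → ℝ) : Matrix (Fin n) (Fin n) ℝ :=
  Matrix.of fun i j => pd i (pd j f) x

theorem fderiv_apply_eq_grad_dotProduct (f : (Fin n → ℝ) → ℝ) (x v : Fin n → ℝ) :
    fderiv ℝ f x v = grad f x ⬝ᵥ v := by
  conv_lhs => rw [pi_eq_sum_univ' v, map_sum]
  exact Finset.sum_congr rfl fun i _ => by rw [map_smul, smul_eq_mul, mul_comm]; rfl

theorem dmap_eq_fderiv {φ : (Fin m → ℝ) → Fin n → ℝ} {x : Fin m → ℝ}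
    (hφ : DifferentiableAt ℝ φ x) (i : Fin m) : dmap φ i x = fderiv ℝ φ x (Pi.single i 1) :=
  funext fun α => congrArg (· (Pi.single i 1)) (fderiv_apply hφ α)

theorem contDiff_grad {k l : WithTop ℕ∞} {f : (Fin n → ℝ) → ℝ} (hf : ContDiff ℝ l f)
    (hkl : k + 1 ≤ l) : ContDiff ℝ k (grad f) :=
  contDiff_pi.2 fun _ => (hf.fderiv_right hkl).clm_apply contDiff_const

theorem isSymm_hess {f : (Fin n → ℝ) → ℝ} (hf : ContDiff ℝ 2 f) (x : Fin n → ℝ) :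
    (hess f x).IsSymm := by
  have hsymm : IsSymmSndFDerivAt ℝ f x :=
    hf.contDiffAt.isSymmSndFDerivAt (by rw [minSmoothness_of_isRCLikeNormedField])
  have hd : DifferentiableAt ℝ (fderiv ℝ f) x :=
    (hf.fderiv_right (m := 1) (by norm_num)).differentiable one_ne_zero x
  have hess_apply (i j : Fin n) :
      hess f x i j = fderiv ℝ (fderiv ℝ f) x (Pi.single i 1) (Pi.single j 1) := by
    change fderiv ℝ (fun y => fderiv ℝ f y (Pi.single j 1)) x _ = _
    rw [fderiv_clm_apply hd (differentiableAt_const _)]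
    simp
  ext i j
  rw [Matrix.transpose_apply, hess_apply, hess_apply, hsymm]

theorem fderiv_grad_apply {f : (Fin n → ℝ) → ℝ} (hf : ContDiff ℝ 2 f) (x v : Fin n → ℝ) :
    fderiv ℝ (grad f) x v = hess f x *ᵥ v := by
  have hd : DifferentiableAt ℝ (grad f) x :=
    (contDiff_grad (k := 1) hf (by norm_num)).differentiable one_ne_zero x
  ext i
  calc fderiv ℝ (grad f) x v i
      = fderiv ℝ (pd i f) x v := (congrArg (· v) (fderiv_apply hd i)).symm
    _ = (hess f x)ᵀ i ⬝ᵥ v := fderiv_apply_eq_grad_dotProduct _ x v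
    _ = (hess f x *ᵥ v) i := by rw [isSymm_hess hf x]; rfl

theorem differentiable_grad_dotProduct {f : (Fin n → ℝ) → ℝ} (hf : ContDiff ℝ 2 f)
    (w : Fin n → ℝ) : Differentiable ℝ fun y => grad f y ⬝ᵥ w :=
  Differentiable.fun_sum fun i _ => (differentiable_pi.1
    ((contDiff_grad (k := 1) hf (by norm_num)).differentiable one_ne_zero) i).mul_const (w i)

theorem grad_grad_dotProduct {f : (Fin n → ℝ) → ℝ} (hf : ContDiff ℝ 2 f) (x w : Fin n → ℝ) :
    grad (fun y => grad f y ⬝ᵥ w) x = hess f x *ᵥ w := by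
  have hd (j : Fin n) : DifferentiableAt ℝ (fun y => grad f y j) x := differentiableAt_pi.1
    ((contDiff_grad (k := 1) hf (by norm_num)).differentiable one_ne_zero x) j
  ext i
  simp only [grad, pd, dotProduct] at hd ⊢
  rw [fderiv_fun_sum fun j _ => (hd j).mul_const (w j), sum_apply]
  refine Finset.sum_congr rfl fun j _ => ?_
  rw [fderiv_mul_const (hd j), smul_apply, smul_eq_mul, mul_comm]
  rfl

theorem fderiv_grad_dotProduct {f : (Fin n → ℝ) → ℝ} (hf : ContDiff ℝ 2 f) (x v w : Fin n → ℝ) :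
    fderiv ℝ (fun y => grad f y ⬝ᵥ w) x v = w ⬝ᵥ hess f x *ᵥ v := by
  rw [fderiv_apply_eq_grad_dotProduct, grad_grad_dotProduct hf, Matrix.dotProduct_mulVec,
    ← Matrix.mulVec_transpose, isSymm_hess hf]
theorem hess_eq_zero {f : (Fin n → ℝ) → ℝ} (hf : ∀ x, grad f x = 0) (x : Fin n → ℝ) :
    hess f x = 0 := by
  ext i j
  have hj : pd j f = fun _ => 0 := funext fun y => congrFun (hf y) j
  simp [hess, hj, pd]

theorem forall_smul_grad_eq_zero_iff {u : (Fin n → ℝ) → ℝ} (hu : Differentiable ℝ u) :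
    (∀ x, u x • grad u x = 0) ↔ ∃ c, ∀ x, |u x| = c := by
  have hsq (x v : Fin n → ℝ) : fderiv ℝ (fun y => u y ^ 2) x v = 2 * ((u x • grad u x) ⬝ᵥ v) := by
    rw [((hu x).hasFDerivAt.pow 2).fderiv]
    simp [fderiv_apply_eq_grad_dotProduct, mul_assoc]
  constructor
  · intro h
    have hconst := is_const_of_fderiv_eq_zero (𝕜 := ℝ) (f := fun y => u y ^ 2) (hu.pow 2)
      fun x => ContinuousLinearMap.ext fun v => by simp [hsq, h]
    exact ⟨|u 0|, fun x => (sq_eq_sq_iff_abs_eq_abs _ _).1 (hconst x 0)⟩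
  · rintro ⟨c, hc⟩ x
    have hconst : (fun y => u y ^ 2) = fun _ => c ^ 2 := funext fun y => by rw [← hc y, sq_abs]
    refine dotProduct_eq_zero_iff.1 fun v => ?_
    simpa [hconst] using (hsq x v).symm

end Calculus

section Christoffel

variable {m n : ℕ}

/-- The value `Γ(X, Y)ᵏ = Γᵏᵢⱼ Xⁱ Yʲ` on vectors of the Christoffel symbols of a metric; it is the
zeroth order part of the Levi-Civita connection. -/
def christoffelForm (g : MetricField n) (x X Y : Fin n → ℝ) : Fin n → ℝ :=
  fun k => ∑ i, ∑ j, christoffel g k i j x * X i * Y j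

theorem covDeriv_eq_fderiv_add (h : MetricField n) (φ : (Fin m → ℝ) → Fin n → ℝ) (i : Fin m)
    {V : (Fin m → ℝ) → Fin n → ℝ} {x : Fin m → ℝ} (hV : DifferentiableAt ℝ V x) :
    covDeriv h φ i V x
      = fderiv ℝ V x (Pi.single i 1) + christoffelForm h (φ x) (dmap φ i x) (V x) := by
  rw [← dmap_eq_fderiv hV]
  rfl

theorem fderiv_christoffelForm {g : MetricField n} {x : Fin n → ℝ}
    (hg : ∀ k i j, DifferentiableAt ℝ (christoffel g k i j) x) (X Y Z : Fin n → ℝ) (l : Fin n) :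
    fderiv ℝ (fun y => christoffelForm g y Y Z) x X l
      = ∑ i, ∑ j, ∑ k, X i * Y j * Z k * pd i (christoffel g l j k) x := by
  have hd (j k : Fin n) := ((hg l j k).mul_const (Y j)).mul_const (Z k)
  have hdiff : DifferentiableAt ℝ (fun y => christoffelForm g y Y Z) x :=
    differentiableAt_pi.2 fun l => DifferentiableAt.fun_sum fun j _ => DifferentiableAt.fun_sum
      fun k _ => ((hg l j k).mul_const (Y j)).mul_const (Z k)
  have hpd (i : Fin n) : pd i (fun y => christoffelForm g y Y Z l) x
      = ∑ j, ∑ k, pd i (christoffel g l j k) x * Y j * Z k := by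
    simp only [pd, christoffelForm]
    rw [fderiv_fun_sum fun j _ => DifferentiableAt.fun_sum fun k _ => hd j k, sum_apply]
    refine Finset.sum_congr rfl fun j _ => ?_
    rw [fderiv_fun_sum fun k _ => hd j k, sum_apply]
    refine Finset.sum_congr rfl fun k _ => ?_
    rw [fderiv_mul_const ((hg l j k).mul_const _), fderiv_mul_const (hg l j k)]
    simp only [smul_apply, smul_eq_mul]
    ring
  calc fderiv ℝ (fun y => christoffelForm g y Y Z) x X l
      = grad (fun y => christoffelForm g y Y Z l) x ⬝ᵥ X := by
        rw [← fderiv_apply_eq_grad_dotProduct, fderiv_apply hdiff l]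
        rfl
    _ = ∑ i, ∑ j, ∑ k, X i * Y j * Z k * pd i (christoffel g l j k) x := by
        simp only [dotProduct, grad, hpd, Finset.sum_mul]
        exact Finset.sum_congr rfl fun i _ => Finset.sum_congr rfl fun j _ =>
          Finset.sum_congr rfl fun k _ => by ring

theorem christoffelForm_christoffelForm (g : MetricField n) (x X Y Z : Fin n → ℝ) (l : Fin n) :
    christoffelForm g x X (christoffelForm g x Y Z) l
      = ∑ i, ∑ j, ∑ k, X i * Y j * Z k * ∑ s, christoffel g s j k x * christoffel g l i s x := by
  simp only [christoffelForm, Finset.mul_sum]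
  refine Finset.sum_congr rfl fun i _ => ?_
  rw [Finset.sum_comm]
  refine Finset.sum_congr rfl fun j _ => ?_
  rw [Finset.sum_comm]
  exact Finset.sum_congr rfl fun k _ => Finset.sum_congr rfl fun s _ => by ring

theorem curvatureOp_eq_christoffelForm {g : MetricField n} {x : Fin n → ℝ}
    (hg : ∀ k i j, DifferentiableAt ℝ (christoffel g k i j) x) (X Y Z : Fin n → ℝ) :
    curvatureOp g x X Y Z
      = fderiv ℝ (fun y => christoffelForm g y Y Z) x X
        - fderiv ℝ (fun y => christoffelForm g y X Z) x Y
        + (christoffelForm g x X (christoffelForm g x Y Z)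
          - christoffelForm g x Y (christoffelForm g x X Z)) := by
  have swap (a : Fin n → Fin n → Fin n → ℝ) :
      ∑ j, ∑ i, ∑ k, Y j * X i * Z k * a j i k = ∑ i, ∑ j, ∑ k, X i * Y j * Z k * a j i k := by
    rw [Finset.sum_comm]
    simp only [mul_comm (Y _)]
  ext l
  simp only [Pi.add_apply, Pi.sub_apply, fderiv_christoffelForm hg,
    christoffelForm_christoffelForm, swap, ← Finset.sum_sub_distrib, ← Finset.sum_add_distrib,
    curvatureOp, curvature, ← mul_sub, ← mul_add]

end Christoffel

section RescaledConstantMetric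

variable {n : ℕ} {ρ : (Fin n → ℝ) → ℝ} {A : Matrix (Fin n) (Fin n) ℝ} {x : Fin n → ℝ}

theorem inv_rescale_const (hA : IsUnit A.det) (hρ : ρ x ≠ 0) :
    (rescale ρ (fun _ => A) x)⁻¹ = (ρ x)⁻¹ • A⁻¹ := by
  apply Matrix.inv_eq_left_inv
  simp [rescale, smul_smul, hρ, Matrix.nonsing_inv_mul _ hA]

theorem christoffel_rescale_const (hA : IsUnit A.det) (hA_symm : A.IsSymm)
    (hρd : DifferentiableAt ℝ ρ x) (hρ : ρ x ≠ 0) (k i j : Fin n) :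
    christoffel (rescale ρ fun _ => A) k i j x
      = (2 * ρ x)⁻¹ * (grad ρ x i * (1 : Matrix (Fin n) (Fin n) ℝ) k j
        + grad ρ x j * (1 : Matrix (Fin n) (Fin n) ℝ) k i - (A⁻¹ *ᵥ grad ρ x) k * A i j) := by
  have hpd (i j l : Fin n) :
      pd i (fun y => rescale ρ (fun _ => A) y j l) x = grad ρ x i * A j l := by
    simp only [pd, rescale, Matrix.smul_apply, smul_eq_mul, fderiv_mul_const hρd]
    exact mul_comm _ _
  have hone (j : Fin n) : (1 : Matrix (Fin n) (Fin n) ℝ) k j = ∑ l, A⁻¹ k l * A j l := by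
    rw [← Matrix.nonsing_inv_mul A hA, Matrix.mul_apply]
    simp only [hA_symm.apply]
  simp only [christoffel, hpd, inv_rescale_const hA hρ, Matrix.smul_apply, smul_eq_mul, hone,
    Matrix.mulVec, dotProduct, Finset.mul_sum, Finset.sum_mul, ← Finset.sum_add_distrib,
    ← Finset.sum_sub_distrib]
  refine Finset.sum_congr rfl fun l _ => ?_
  rw [mul_inv]
  ring

theorem sum_inv_mul_christoffel_rescale_const (hA : IsUnit A.det) (hA_symm : A.IsSymm)
    (hρd : DifferentiableAt ℝ ρ x) (hρ : ρ x ≠ 0) (k : Fin n) :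
    ∑ i, ∑ j, A⁻¹ i j * christoffel (rescale ρ fun _ => A) k i j x
      = (2 - n) / (2 * ρ x) * (A⁻¹ *ᵥ grad ρ x) k := by
  have hinv_symm (i j : Fin n) : A⁻¹ i j = A⁻¹ j i := hA_symm.inv.apply j i
  have htrace : ∑ i, ∑ j, A⁻¹ i j * A i j = n := by
    calc ∑ i, ∑ j, A⁻¹ i j * A i j = (A⁻¹ * A).trace := by
          simp only [Matrix.trace, Matrix.diag, Matrix.mul_apply, hA_symm.apply]
      _ = n := by simp [Matrix.nonsing_inv_mul A hA]
  have hleft : ∑ i, ∑ j, A⁻¹ i j * (grad ρ x i * (1 : Matrix (Fin n) (Fin n) ℝ) k j)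
      = (A⁻¹ *ᵥ grad ρ x) k := by
    simp [Matrix.one_apply, Matrix.mulVec, dotProduct, hinv_symm k]
  have hright : ∑ i, ∑ j, A⁻¹ i j * (grad ρ x j * (1 : Matrix (Fin n) (Fin n) ℝ) k i)
      = (A⁻¹ *ᵥ grad ρ x) k := by
    simp [Matrix.one_apply, Matrix.mulVec, dotProduct]
  calc ∑ i, ∑ j, A⁻¹ i j * christoffel (rescale ρ fun _ => A) k i j x
      = (2 * ρ x)⁻¹ * (∑ i, ∑ j, A⁻¹ i j * (grad ρ x i * (1 : Matrix (Fin n) (Fin n) ℝ) k j)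
        + ∑ i, ∑ j, A⁻¹ i j * (grad ρ x j * (1 : Matrix (Fin n) (Fin n) ℝ) k i)
        - (A⁻¹ *ᵥ grad ρ x) k * ∑ i, ∑ j, A⁻¹ i j * A i j) := by
        simp only [christoffel_rescale_const hA hA_symm hρd hρ, Finset.mul_sum,
          ← Finset.sum_add_distrib, ← Finset.sum_sub_distrib]
        exact Finset.sum_congr rfl fun i _ => Finset.sum_congr rfl fun j _ => by ring
    _ = (2 - n) / (2 * ρ x) * (A⁻¹ *ᵥ grad ρ x) k := by
        rw [hleft, hright, htrace]
        ring

/-- The first order term is the failure of conformal invariance: it is absent exactly in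
dimension two. -/
theorem sum_inv_rescale_const_smul_sub_christoffel {E : Type*} [AddCommGroup E] [Module ℝ E]
    (hA : IsUnit A.det) (hA_symm : A.IsSymm) (hρd : DifferentiableAt ℝ ρ x) (hρ : ρ x ≠ 0)
    (S : Fin n → Fin n → E) (B : Fin n → E) :
    ∑ i, ∑ j, (rescale ρ (fun _ => A) x)⁻¹ i j
        • (S i j - ∑ k, christoffel (rescale ρ fun _ => A) k i j x • B k)
      = (ρ x)⁻¹ • (∑ i, ∑ j, A⁻¹ i j • S i j
        - ((2 - n) / (2 * ρ x)) • ∑ k, (A⁻¹ *ᵥ grad ρ x) k • B k) := by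
  have htrace : ∑ i, ∑ j, A⁻¹ i j • ∑ k, christoffel (rescale ρ fun _ => A) k i j x • B k
      = ((2 - n) / (2 * ρ x)) • ∑ k, (A⁻¹ *ᵥ grad ρ x) k • B k := by
    simp only [Finset.smul_sum, smul_smul,
      ← sum_inv_mul_christoffel_rescale_const hA hA_symm hρd hρ, Finset.sum_smul]
    exact Finset.sum_comm_cycle
  rw [← htrace, inv_rescale_const hA hρ]
  simp only [Matrix.smul_apply, smul_assoc, smul_sub, Finset.sum_sub_distrib, Finset.smul_sum]

end RescaledConstantMetric

section ConformallyFlatMetric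

variable {n : ℕ}

/-- The conformally flat metric `G⁻² (dx₁² + ⋯ + dxₙ²)`. -/
def conformalMetric (G : (Fin n → ℝ) → ℝ) : MetricField n :=
  rescale (fun q => (G q ^ 2)⁻¹) (euclideanMetric n)

theorem rescale_rescale (u v : (Fin n → ℝ) → ℝ) (g : MetricField n) :
    rescale u (rescale v g) = rescale (fun x => u x * v x) g :=
  funext fun _ => smul_smul _ _ _

theorem rescale_rescale_euclideanMetric (F β : (Fin n → ℝ) → ℝ) :
    rescale (fun q => (β q ^ 2)⁻¹) (rescale (fun q => (F q ^ 2)⁻¹) (euclideanMetric n))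
      = conformalMetric fun q => F q * β q := by
  simp only [rescale_rescale, conformalMetric, mul_pow, mul_inv, mul_comm]

theorem metricInner_conformalMetric (G : (Fin n → ℝ) → ℝ) (q X Y : Fin n → ℝ) :
    metricInner (conformalMetric G) q X Y = (G q ^ 2)⁻¹ * (X ⬝ᵥ Y) := by
  simp [metricInner, conformalMetric, rescale, euclideanMetric, Matrix.one_apply, dotProduct,
    Finset.mul_sum, mul_assoc]

theorem isRiemannianMetric_conformalMetric {G : (Fin n → ℝ) → ℝ} (hG : ContDiff ℝ ∞ G)
    (hG0 : ∀ q, G q ≠ 0) : IsRiemannianMetric (conformalMetric G) := by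
  refine ⟨fun i j => ?_, fun q => Matrix.PosDef.one.smul (by have := hG0 q; positivity)⟩
  exact ((hG.pow 2).inv fun q => pow_ne_zero 2 (hG0 q)).mul contDiff_const

theorem grad_inv_sq {G : (Fin n → ℝ) → ℝ} {q : Fin n → ℝ} (hG : DifferentiableAt ℝ G q)
    (hG0 : G q ≠ 0) : grad (fun y => (G y ^ 2)⁻¹) q = (-2 / G q ^ 3) • grad G q := by
  have h := (hasDerivAt_inv (pow_ne_zero 2 hG0)).comp_hasFDerivAt q (hG.hasFDerivAt.pow 2)
  ext i
  change fderiv ℝ (Inv.inv ∘ fun y => G y ^ 2) q _ = _ * fderiv ℝ G q _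
  rw [h.fderiv]
  simp only [smul_apply, smul_eq_mul, nsmul_eq_mul, Nat.cast_ofNat, Nat.add_one_sub_one, pow_one]
  field_simp

theorem christoffel_conformalMetric {G : (Fin n → ℝ) → ℝ} {q : Fin n → ℝ}
    (hG : DifferentiableAt ℝ G q) (hG0 : G q ≠ 0) (k i j : Fin n) :
    christoffel (conformalMetric G) k i j q
      = -(G q)⁻¹ * (grad G q i * (1 : Matrix (Fin n) (Fin n) ℝ) k j
        + grad G q j * (1 : Matrix (Fin n) (Fin n) ℝ) k i
        - grad G q k * (1 : Matrix (Fin n) (Fin n) ℝ) i j) := by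
  have hρ : DifferentiableAt ℝ (fun y => (G y ^ 2)⁻¹) q := (hG.pow 2).inv (pow_ne_zero 2 hG0)
  have h := christoffel_rescale_const (A := 1) (by simp) Matrix.isSymm_one hρ
    (inv_ne_zero (pow_ne_zero 2 hG0)) k i j
  refine h.trans ?_
  simp only [grad_inv_sq hG hG0, inv_one, Matrix.one_mulVec, Pi.smul_apply, smul_eq_mul]
  field_simp
  ring

theorem christoffelForm_conformalMetric {G : (Fin n → ℝ) → ℝ} {q : Fin n → ℝ}
    (hG : DifferentiableAt ℝ G q) (hG0 : G q ≠ 0) (X Y : Fin n → ℝ) :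
    christoffelForm (conformalMetric G) q X Y
      = -(G q)⁻¹ • ((grad G q ⬝ᵥ X) • Y + (grad G q ⬝ᵥ Y) • X - (X ⬝ᵥ Y) • grad G q) := by
  ext k
  simp only [christoffelForm, christoffel_conformalMetric hG hG0, mul_assoc, ← Finset.mul_sum,
    Pi.smul_apply, smul_eq_mul]
  congr 1
  simp only [Pi.add_apply, Pi.sub_apply, Pi.smul_apply, smul_eq_mul, dotProduct, add_mul, sub_mul,
    Finset.sum_add_distrib, Finset.sum_sub_distrib, Matrix.one_apply, mul_ite, mul_one, mul_zero,
    ite_mul, zero_mul, Finset.sum_ite_eq, Finset.mem_univ, if_true, Finset.sum_mul,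
    Finset.sum_ite_irrel, Finset.sum_const_zero]
  simp only [mul_comm, mul_left_comm]

theorem fderiv_christoffelForm_conformalMetric {G : (Fin n → ℝ) → ℝ} (hG : ContDiff ℝ 2 G)
    (hG0 : ∀ q, G q ≠ 0) (q X Y Z : Fin n → ℝ) :
    fderiv ℝ (fun y => christoffelForm (conformalMetric G) y Y Z) q X
      = ((grad G q ⬝ᵥ X) / G q ^ 2)
          • ((grad G q ⬝ᵥ Y) • Z + (grad G q ⬝ᵥ Z) • Y - (Y ⬝ᵥ Z) • grad G q)
        - (G q)⁻¹ • ((Y ⬝ᵥ hess G q *ᵥ X) • Z + (Z ⬝ᵥ hess G q *ᵥ X) • Y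
          - (Y ⬝ᵥ Z) • hess G q *ᵥ X) := by
  have hGd : Differentiable ℝ G := hG.differentiable two_ne_zero
  have hgrad : Differentiable ℝ (grad G) :=
    (contDiff_grad (k := 1) hG (by norm_num)).differentiable one_ne_zero
  have hdot (W : Fin n → ℝ) : DifferentiableAt ℝ (fun y => grad G y ⬝ᵥ W) q :=
    differentiable_grad_dotProduct hG W q
  have hinv : HasFDerivAt (fun y => -(G y)⁻¹) ((G q ^ 2)⁻¹ • fderiv ℝ G q) q := by
    have h := (hasDerivAt_inv (hG0 q)).fun_neg.comp_hasFDerivAt q (hGd q).hasFDerivAt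
    exact h.congr_fderiv (by rw [neg_neg])
  have hY := (hdot Y).smul_const Z
  have hZ := (hdot Z).smul_const Y
  have hYZ := (hgrad q).fun_const_smul (Y ⬝ᵥ Z)
  simp only [fun y => christoffelForm_conformalMetric (hGd y) (hG0 y) Y Z]
  rw [fderiv_fun_smul hinv.differentiableAt ((hY.fun_add hZ).fun_sub hYZ),
    fderiv_fun_sub (hY.fun_add hZ) hYZ, fderiv_fun_add hY hZ, fderiv_smul_const (hdot Y),
    fderiv_smul_const (hdot Z), fderiv_fun_const_smul (hgrad q), hinv.fderiv]
  simp only [add_apply, sub_apply, smul_apply, ContinuousLinearMap.smulRight_apply,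
    fderiv_grad_dotProduct hG, fderiv_grad_apply hG, fderiv_apply_eq_grad_dotProduct,
    smul_eq_mul]
  module

theorem curvatureOp_conformalMetric {G : (Fin n → ℝ) → ℝ} (hG : ContDiff ℝ 2 G)
    (hG0 : ∀ q, G q ≠ 0) (q X Y Z : Fin n → ℝ) :
    curvatureOp (conformalMetric G) q X Y Z
      = (G q)⁻¹ • ((Z ⬝ᵥ hess G q *ᵥ Y) • X - (Z ⬝ᵥ hess G q *ᵥ X) • Y
          + (Y ⬝ᵥ Z) • hess G q *ᵥ X - (X ⬝ᵥ Z) • hess G q *ᵥ Y)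
        - ((grad G q ⬝ᵥ grad G q) / G q ^ 2) • ((Y ⬝ᵥ Z) • X - (X ⬝ᵥ Z) • Y) := by
  have hGd : Differentiable ℝ G := hG.differentiable two_ne_zero
  have hΓ (k i j : Fin n) : DifferentiableAt ℝ (christoffel (conformalMetric G) k i j) q := by
    have hgrad (i : Fin n) : DifferentiableAt ℝ (fun y => grad G y i) q := differentiableAt_pi.1
      ((contDiff_grad (k := 1) hG (by norm_num)).differentiable one_ne_zero q) i
    rw [funext fun y => christoffel_conformalMetric (hGd y) (hG0 y) k i j]
    exact ((hGd q).inv (hG0 q)).neg.mul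
      ((((hgrad i).mul_const _).add ((hgrad j).mul_const _)).sub ((hgrad k).mul_const _))
  have hsymm : X ⬝ᵥ hess G q *ᵥ Y = Y ⬝ᵥ hess G q *ᵥ X := by
    rw [Matrix.dotProduct_mulVec, dotProduct_comm, ← Matrix.mulVec_transpose, isSymm_hess hG q]
  rw [curvatureOp_eq_christoffelForm hΓ, fderiv_christoffelForm_conformalMetric hG hG0,
    fderiv_christoffelForm_conformalMetric hG hG0]
  simp only [christoffelForm_conformalMetric (hGd q) (hG0 q), dotProduct_smul, dotProduct_add,
    dotProduct_sub, smul_eq_mul, hsymm, dotProduct_comm Y X, dotProduct_comm _ (grad G q)]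
  have := hG0 q
  ext l
  simp only [Pi.add_apply, Pi.sub_apply, Pi.smul_apply, smul_eq_mul]
  field_simp
  ring

end ConformallyFlatMetric

section TangentProjection

variable {m n : ℕ} {T : Matrix (Fin m) (Fin n) ℝ}

theorem isSymm_mul_transpose (T : Matrix (Fin m) (Fin n) ℝ) : (T * Tᵀ).IsSymm := by
  rw [Matrix.IsSymm, Matrix.transpose_mul, Matrix.transpose_transpose]

theorem posDef_mul_transpose (hT : LinearIndependent ℝ T.row) : (T * Tᵀ).PosDef := by
  simpa only [Matrix.conjTranspose_eq_transpose_of_trivial] using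
    Matrix.PosDef.mul_conjTranspose_self T (Matrix.vecMul_injective_iff.2 hT)

theorem isUnit_det_mul_transpose (hT : LinearIndependent ℝ T.row) : IsUnit (T * Tᵀ).det :=
  (posDef_mul_transpose hT).det_pos.ne'.isUnit

/-- The matrix of the orthogonal projection of `ℝⁿ` onto the span of the rows of `T`, provided that
these are linearly independent. -/
def rowProj (T : Matrix (Fin m) (Fin n) ℝ) : Matrix (Fin n) (Fin n) ℝ :=
  Tᵀ * (T * Tᵀ)⁻¹ * T

theorem rowProj_mulVec (T : Matrix (Fin m) (Fin n) ℝ) (v : Fin n → ℝ) :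
    rowProj T *ᵥ v = ((T * Tᵀ)⁻¹ *ᵥ T *ᵥ v) ᵥ* T := by
  rw [rowProj, ← Matrix.mulVec_transpose, Matrix.mulVec_mulVec, Matrix.mulVec_mulVec]

/-- The trace of a bilinear form, given by its values `S i j` on the rows `tᵢ` and `tⱼ` of `T`, with
respect to the Euclidean inner product of the span of the rows. -/
def gramTrace {E : Type*} [AddCommGroup E] [Module ℝ E] (T : Matrix (Fin m) (Fin n) ℝ)
    (S : Fin m → Fin m → E) : E :=
  ∑ i, ∑ j, (T * Tᵀ)⁻¹ i j • S i j

section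

variable {E : Type*} [AddCommGroup E] [Module ℝ E] (T : Matrix (Fin m) (Fin n) ℝ)

theorem gramTrace_add (S S' : Fin m → Fin m → E) :
    gramTrace T (fun i j => S i j + S' i j) = gramTrace T S + gramTrace T S' := by
  simp only [gramTrace, smul_add, Finset.sum_add_distrib]

theorem gramTrace_sub (S S' : Fin m → Fin m → E) :
    gramTrace T (fun i j => S i j - S' i j) = gramTrace T S - gramTrace T S' := by
  simp only [gramTrace, smul_sub, Finset.sum_sub_distrib]

theorem gramTrace_smul (c : ℝ) (S : Fin m → Fin m → E) :
    gramTrace T (fun i j => c • S i j) = c • gramTrace T S := by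
  simp only [gramTrace, smul_comm _ c, Finset.smul_sum]

theorem gramTrace_smul_const (s : Fin m → Fin m → ℝ) (v : E) :
    gramTrace T (fun i j => s i j • v) = gramTrace T s • v := by
  simp only [gramTrace, smul_smul, Finset.sum_smul, smul_eq_mul]

end

theorem gramTrace_swap {E : Type*} [AddCommGroup E] [Module ℝ E] (T : Matrix (Fin m) (Fin n) ℝ)
    (S : Fin m → Fin m → E) : gramTrace T (fun i j => S j i) = gramTrace T S := by
  rw [gramTrace, Finset.sum_comm]
  simp only [gramTrace, (isSymm_mul_transpose T).inv.apply]

theorem gramTrace_smul_row (T : Matrix (Fin m) (Fin n) ℝ) (w : Fin m → ℝ) :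
    gramTrace T (fun i j => w j • T i) = ((T * Tᵀ)⁻¹ *ᵥ w) ᵥ* T := by
  simp only [gramTrace, Matrix.vecMul_eq_sum, Matrix.mulVec, dotProduct, Finset.sum_smul, smul_smul]

theorem gramTrace_dotProduct_smul_row (T : Matrix (Fin m) (Fin n) ℝ) (v : Fin n → ℝ) :
    gramTrace T (fun i j => (v ⬝ᵥ T j) • T i) = rowProj T *ᵥ v := by
  rw [gramTrace_smul_row, rowProj_mulVec]
  simp only [dotProduct_comm v]
  rfl

theorem gramTrace_row_dotProduct_mulVec (T : Matrix (Fin m) (Fin n) ℝ)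
    (A : Matrix (Fin n) (Fin n) ℝ) :
    gramTrace T (fun i j => T j ⬝ᵥ A *ᵥ T i) = (rowProj T * A).trace := by
  calc gramTrace T (fun i j => T j ⬝ᵥ A *ᵥ T i)
      = ((T * Tᵀ)⁻¹ * (T * (A * Tᵀ))).trace := by
        simp only [gramTrace, Matrix.trace, Matrix.diag, Matrix.mul_apply' (M := (T * Tᵀ)⁻¹)]
        rfl
    _ = (rowProj T * A).trace := by
        rw [rowProj, ← Matrix.mul_assoc T, ← Matrix.mul_assoc, Matrix.trace_mul_comm]
        simp only [Matrix.mul_assoc]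

theorem gramTrace_row_dotProduct_row (hT : LinearIndependent ℝ T.row) :
    gramTrace T (fun i j => T i ⬝ᵥ T j) = m := by
  calc gramTrace T (fun i j => T i ⬝ᵥ T j)
      = ((T * Tᵀ)⁻¹ * (T * Tᵀ)ᵀ).trace := rfl
    _ = m := by
        rw [isSymm_mul_transpose, Matrix.nonsing_inv_mul _ (isUnit_det_mul_transpose hT),
          Matrix.trace_one, Fintype.card_fin]

end TangentProjection

section Hyperplane

variable {m n : ℕ}

theorem dotProduct_self_pos {N : Fin n → ℝ} (hN : N ≠ 0) : 0 < N ⬝ᵥ N := by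
  simpa only [star_trivial] using Matrix.dotProduct_star_self_pos_iff.2 hN

theorem smul_normal_add_vecMul_eq_zero {T : Matrix (Fin m) (Fin n) ℝ} {N : Fin n → ℝ}
    (hT : LinearIndependent ℝ T.row) (hN : N ≠ 0) (hTN : T *ᵥ N = 0) {c : ℝ} {w : Fin m → ℝ} :
    c • N + w ᵥ* T = 0 ↔ c = 0 ∧ w = 0 := by
  refine ⟨fun h => ?_, by rintro ⟨rfl, rfl⟩; simp⟩
  have hc : c = 0 := by
    have : c * (N ⬝ᵥ N) = 0 := by
      simpa [add_dotProduct, ← Matrix.dotProduct_mulVec, hTN] using congrArg (· ⬝ᵥ N) h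
    exact (mul_eq_zero.1 this).resolve_right (dotProduct_self_pos hN).ne'
  refine ⟨hc, Matrix.vecMul_injective_iff.2 hT ?_⟩
  simpa [hc] using h

theorem linearIndependent_cons_normal {T : Matrix (Fin m) (Fin n) ℝ} {N : Fin n → ℝ}
    (hT : LinearIndependent ℝ T.row) (hN : N ≠ 0) (hTN : T *ᵥ N = 0) :
    LinearIndependent ℝ (Fin.cons N T.row : Fin (m + 1) → Fin n → ℝ) := by
  refine linearIndependent_finCons.2 ⟨hT, fun hmem => ?_⟩
  obtain ⟨w, hw⟩ := (Submodule.mem_span_range_iff_exists_fun ℝ).1 hmem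
  have : (-1 : ℝ) • N + w ᵥ* T = 0 := by
    rw [Matrix.vecMul_eq_sum, neg_one_smul]
    exact neg_add_eq_zero.2 hw.symm
  exact absurd ((smul_normal_add_vecMul_eq_zero hT hN hTN).1 this).1 (by norm_num)

variable {T : Matrix (Fin m) (Fin (m + 1)) ℝ} {N : Fin (m + 1) → ℝ}

theorem rowProj_eq_one_sub (hT : LinearIndependent ℝ T.row) (hN : N ≠ 0) (hTN : T *ᵥ N = 0) :
    rowProj T = 1 - (N ⬝ᵥ N)⁻¹ • Matrix.vecMulVec N N := by
  have hNN : N ⬝ᵥ N ≠ 0 := (dotProduct_self_pos hN).ne'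
  have hM : IsUnit (Matrix.of (Fin.cons N T.row : Fin (m + 1) → Fin (m + 1) → ℝ)) :=
    Matrix.linearIndependent_rows_iff_isUnit.1 (linearIndependent_cons_normal hT hN hTN)
  set D := rowProj T - (1 - (N ⬝ᵥ N)⁻¹ • Matrix.vecMulVec N N) with hD
  have hTD : T * D = 0 := by
    simp [hD, rowProj, Matrix.mul_sub, ← Matrix.mul_assoc, Matrix.mul_vecMulVec, hTN,
      Matrix.mul_nonsing_inv _ (isUnit_det_mul_transpose hT)]
  have hND : N ᵥ* D = 0 := by
    simp [hD, rowProj, Matrix.vecMul_sub, Matrix.vecMul_smul, Matrix.vecMul_vecMulVec,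
      ← Matrix.vecMul_vecMul, Matrix.vecMul_transpose, hTN, hNN]
  refine sub_eq_zero.1 (hM.mul_right_eq_zero.1 (Matrix.ext_row fun i => ?_))
  refine Fin.cases hND (fun i => ?_) i
  exact congrArg (· i) hTD

theorem rowProj_mulVec_eq_sub (hT : LinearIndependent ℝ T.row) (hN : N ≠ 0) (hTN : T *ᵥ N = 0)
    (v : Fin (m + 1) → ℝ) : rowProj T *ᵥ v = v - ((v ⬝ᵥ N) / (N ⬝ᵥ N)) • N := by
  rw [rowProj_eq_one_sub hT hN hTN, Matrix.sub_mulVec, Matrix.one_mulVec, Matrix.smul_mulVec,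
    Matrix.vecMulVec_mulVec, op_smul_eq_smul, smul_smul, inv_mul_eq_div, dotProduct_comm]

theorem trace_rowProj_mul (hT : LinearIndependent ℝ T.row) (hN : N ≠ 0) (hTN : T *ᵥ N = 0)
    (A : Matrix (Fin (m + 1)) (Fin (m + 1)) ℝ) :
    (rowProj T * A).trace = A.trace - (N ⬝ᵥ A *ᵥ N) / (N ⬝ᵥ N) := by
  rw [rowProj_eq_one_sub hT hN hTN, Matrix.sub_mul, Matrix.one_mul, Matrix.trace_sub,
    Matrix.smul_mul, Matrix.trace_smul, Matrix.vecMulVec_mul, Matrix.trace_vecMulVec,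
    dotProduct_comm N (N ᵥ* A), ← Matrix.dotProduct_mulVec, smul_eq_mul, inv_mul_eq_div]

end Hyperplane

section AffineMap

variable {m n : ℕ}

/-- The affine parametrization of the affine subspace through `b` whose coordinate vector fields are
the rows of `T`. -/
def affineMap (T : Matrix (Fin m) (Fin n) ℝ) (b : Fin n → ℝ) (p : Fin m → ℝ) : Fin n → ℝ :=
  p ᵥ* T + b

theorem hasFDerivAt_affineMap (T : Matrix (Fin m) (Fin n) ℝ) (b : Fin n → ℝ) (p : Fin m → ℝ) :
    HasFDerivAt (affineMap T b) T.vecMulLinear.toContinuousLinearMap p :=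
  T.vecMulLinear.toContinuousLinearMap.hasFDerivAt.add_const b

theorem contDiff_affineMap {k : WithTop ℕ∞} (T : Matrix (Fin m) (Fin n) ℝ) (b : Fin n → ℝ) :
    ContDiff ℝ k (affineMap T b) :=
  T.vecMulLinear.toContinuousLinearMap.contDiff.add contDiff_const

theorem dmap_affineMap (T : Matrix (Fin m) (Fin n) ℝ) (b : Fin n → ℝ) (i : Fin m)
    (p : Fin m → ℝ) : dmap (affineMap T b) i p = T i := by
  have h := hasFDerivAt_affineMap T b p
  rw [dmap_eq_fderiv h.differentiableAt, h.fderiv]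
  exact Matrix.single_one_vecMul i T

theorem grad_comp_affineMap {u : (Fin n → ℝ) → ℝ} {T : Matrix (Fin m) (Fin n) ℝ} {b : Fin n → ℝ}
    {p : Fin m → ℝ} (hu : DifferentiableAt ℝ u (affineMap T b p)) :
    grad (fun y => u (affineMap T b y)) p = T *ᵥ grad u (affineMap T b p) := by
  ext i
  have h := hasFDerivAt_affineMap T b p
  calc fderiv ℝ (fun y => u (affineMap T b y)) p (Pi.single i 1)
      = fderiv ℝ u (affineMap T b p) (Pi.single i 1 ᵥ* T) := by
        rw [fderiv_fun_comp p hu h.differentiableAt, h.fderiv]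
        rfl
    _ = (T *ᵥ grad u (affineMap T b p)) i := by
        rw [fderiv_apply_eq_grad_dotProduct, dotProduct_comm, Matrix.single_one_vecMul]
        rfl

theorem pullback_affineMap (T : Matrix (Fin m) (Fin n) ℝ) (b : Fin n → ℝ) (G : (Fin n → ℝ) → ℝ) :
    pullback (affineMap T b) (conformalMetric G)
      = rescale (fun p => (G (affineMap T b p) ^ 2)⁻¹) fun _ => T * Tᵀ := by
  ext p i j
  simp only [pullback, Matrix.of_apply, metricInner_conformalMetric, dmap_affineMap]
  rfl

theorem isConformalImmersion_affineMap {T : Matrix (Fin m) (Fin n) ℝ} (b : Fin n → ℝ)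
    (hT : LinearIndependent ℝ T.row) {G : (Fin n → ℝ) → ℝ} (hG : ContDiff ℝ ∞ G)
    (hG0 : ∀ q, G q ≠ 0) {f : (Fin m → ℝ) → ℝ} (hf : ContDiff ℝ ∞ f) (hf_pos : ∀ p, 0 < f p) :
    IsConformalImmersion
      (rescale (fun p => (f p)⁻¹) (pullback (affineMap T b) (conformalMetric G)))
      (conformalMetric G) (affineMap T b) fun p => √(f p) := by
  refine ⟨⟨fun i j => ?_, fun p => ?_⟩, isRiemannianMetric_conformalMetric hG hG0,
    contDiff_affineMap T b, fun p => ?_, fun p => Real.sqrt_pos.2 (hf_pos p), ?_⟩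
  · simp only [pullback_affineMap, rescale, Matrix.smul_apply]
    exact (hf.inv fun p => (hf_pos p).ne').smul
      ((((hG.comp (contDiff_affineMap T b)).pow 2).inv fun p => pow_ne_zero 2 (hG0 _)).smul
        contDiff_const)
  · rw [pullback_affineMap]
    have := hG0 (affineMap T b p)
    exact ((posDef_mul_transpose hT).smul (by positivity)).smul (inv_pos.2 (hf_pos p))
  · rw [(hasFDerivAt_affineMap T b p).fderiv]
    exact Matrix.vecMul_injective_iff.2 hT
  · ext p i j
    simp only [rescale, smul_smul, Real.sq_sqrt (hf_pos p).le, mul_inv_cancel₀ (hf_pos p).ne',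
      one_smul]

theorem secondFundForm_affineMap (g : MetricField m) (T : Matrix (Fin m) (Fin n) ℝ)
    (b : Fin n → ℝ) (h : MetricField n) (i j : Fin m) (p : Fin m → ℝ) :
    secondFundForm g h (affineMap T b) i j p
      = christoffelForm h (affineMap T b p) (T i) (T j) - ∑ k, christoffel g k i j p • T k := by
  have hdmap : dmap (affineMap T b) j = fun _ => T j := funext (dmap_affineMap T b j)
  rw [secondFundForm, hdmap, covDeriv_eq_fderiv_add _ _ _ (differentiableAt_const _)]
  simp only [dmap_affineMap, fderiv_fun_const, Pi.zero_apply, zero_apply, zero_add]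

theorem gramTrace_christoffelForm_conformalMetric {T : Matrix (Fin m) (Fin n) ℝ}
    (hT : LinearIndependent ℝ T.row) {G : (Fin n → ℝ) → ℝ} {q : Fin n → ℝ}
    (hG : DifferentiableAt ℝ G q) (hG0 : G q ≠ 0) :
    gramTrace T (fun i j => christoffelForm (conformalMetric G) q (T i) (T j))
      = (G q)⁻¹ • ((m : ℝ) • grad G q - (2 : ℝ) • rowProj T *ᵥ grad G q) := by
  simp only [christoffelForm_conformalMetric hG hG0, gramTrace_smul, gramTrace_sub, gramTrace_add,
    gramTrace_smul_const, gramTrace_row_dotProduct_row hT,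
    gramTrace_swap T fun i j => (grad G q ⬝ᵥ T j) • T i, gramTrace_dotProduct_smul_row]
  module

theorem tension_affineMap {T : Matrix (Fin m) (Fin n) ℝ} {b : Fin n → ℝ}
    (hT : LinearIndependent ℝ T.row) {G : (Fin n → ℝ) → ℝ} {ρ : (Fin m → ℝ) → ℝ} {p : Fin m → ℝ}
    (hG : DifferentiableAt ℝ G (affineMap T b p)) (hG0 : G (affineMap T b p) ≠ 0)
    (hρ : DifferentiableAt ℝ ρ p) (hρ0 : ρ p ≠ 0) :
    tension (rescale ρ fun _ => T * Tᵀ) (conformalMetric G) (affineMap T b) p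
      = (ρ p)⁻¹ • ((G (affineMap T b p))⁻¹ • ((m : ℝ) • grad G (affineMap T b p)
          - (2 : ℝ) • rowProj T *ᵥ grad G (affineMap T b p))
        - ((2 - m) / (2 * ρ p)) • ((T * Tᵀ)⁻¹ *ᵥ grad ρ p) ᵥ* T) := by
  simp only [tension, secondFundForm_affineMap]
  refine (sum_inv_rescale_const_smul_sub_christoffel (isUnit_det_mul_transpose hT)
    (isSymm_mul_transpose T) hρ hρ0 _ _).trans ?_
  rw [← gramTrace_christoffelForm_conformalMetric hT hG hG0, Matrix.vecMul_eq_sum]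
  rfl

theorem meanCurvatureVector_affineMap {T : Matrix (Fin m) (Fin n) ℝ} {b : Fin n → ℝ}
    (hm : m ≠ 0) (hT : LinearIndependent ℝ T.row) {G : (Fin n → ℝ) → ℝ} {p : Fin m → ℝ}
    (hG : DifferentiableAt ℝ G (affineMap T b p)) (hG0 : G (affineMap T b p) ≠ 0) :
    meanCurvatureVector (conformalMetric G) (affineMap T b) p
      = G (affineMap T b p)
        • (grad G (affineMap T b p) - rowProj T *ᵥ grad G (affineMap T b p)) := by
  set q := affineMap T b p with hq
  have hρ : DifferentiableAt ℝ (fun y => (G y ^ 2)⁻¹) q := (hG.pow 2).inv (pow_ne_zero 2 hG0)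
  have hgrad : grad (fun y => (G (affineMap T b y) ^ 2)⁻¹) p
      = (-2 / G q ^ 3) • T *ᵥ grad G q := by
    rw [grad_comp_affineMap (u := fun y => (G y ^ 2)⁻¹) hρ, grad_inv_sq hG hG0, Matrix.mulVec_smul]
  have hρφ : DifferentiableAt ℝ (fun y => (G (affineMap T b y) ^ 2)⁻¹) p :=
    (hρ.comp p (hasFDerivAt_affineMap T b p).differentiableAt :)
  rw [meanCurvatureVector, pullback_affineMap,
    tension_affineMap hT hG hG0 hρφ (inv_ne_zero (pow_ne_zero 2 hG0)), hgrad,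
    Matrix.mulVec_smul, Matrix.smul_vecMul, ← rowProj_mulVec, ← hq]
  have : (m : ℝ) ≠ 0 := Nat.cast_ne_zero.2 hm
  ext k
  simp only [Pi.smul_apply, Pi.sub_apply, smul_eq_mul]
  field_simp
  ring

end AffineMap

section Hypersurface

variable {m : ℕ} {T : Matrix (Fin m) (Fin (m + 1)) ℝ} {b N : Fin (m + 1) → ℝ}
  {G : (Fin (m + 1) → ℝ) → ℝ}

theorem meanCurvatureVector_affineMap_codim_one (hm : m ≠ 0) (hT : LinearIndependent ℝ T.row)
    (hN : N ≠ 0) (hTN : T *ᵥ N = 0) {p : Fin m → ℝ}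
    (hG : DifferentiableAt ℝ G (affineMap T b p)) (hG0 : G (affineMap T b p) ≠ 0) :
    meanCurvatureVector (conformalMetric G) (affineMap T b) p
      = (G (affineMap T b p) * (grad G (affineMap T b p) ⬝ᵥ N) / (N ⬝ᵥ N)) • N := by
  rw [meanCurvatureVector_affineMap hm hT hG hG0, rowProj_mulVec_eq_sub hT hN hTN, sub_sub_cancel,
    smul_smul, mul_div_assoc]

theorem isUnitNormal_affineMap (hN : N ≠ 0) (hTN : T *ᵥ N = 0) (hG : ContDiff ℝ ∞ G)
    (hG0 : ∀ q, G q ≠ 0) :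
    IsUnitNormal (conformalMetric G) (affineMap T b)
      fun p => (G (affineMap T b p) / √(N ⬝ᵥ N)) • N := by
  have hNN : 0 < N ⬝ᵥ N := dotProduct_self_pos hN
  refine ⟨((hG.comp (contDiff_affineMap T b)).div_const _).smul contDiff_const,
    fun p => ⟨?_, fun i => ?_⟩⟩
  · have := hG0 (affineMap T b p)
    rw [metricInner_conformalMetric, smul_dotProduct, dotProduct_smul, smul_eq_mul, smul_eq_mul]
    field_simp
    rw [Real.sq_sqrt hNN.le]
  · have : N ⬝ᵥ T i = 0 := (dotProduct_comm _ _).trans (congrFun hTN i)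
    rw [metricInner_conformalMetric, dmap_affineMap, smul_dotProduct, this, smul_zero, mul_zero]

theorem meanCurvature_affineMap (hm : m ≠ 0) (hT : LinearIndependent ℝ T.row)
    (hN : N ≠ 0) (hTN : T *ᵥ N = 0) {p : Fin m → ℝ}
    (hG : DifferentiableAt ℝ G (affineMap T b p)) (hG0 : G (affineMap T b p) ≠ 0) :
    meanCurvature (conformalMetric G) (affineMap T b)
        (fun p => (G (affineMap T b p) / √(N ⬝ᵥ N)) • N) p
      = (grad G (affineMap T b p) ⬝ᵥ N) / √(N ⬝ᵥ N) := by
  have hNN : 0 < N ⬝ᵥ N := dotProduct_self_pos hN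
  rw [meanCurvature, meanCurvatureVector_affineMap_codim_one hm hT hN hTN hG hG0,
    metricInner_conformalMetric, smul_dotProduct, dotProduct_smul, smul_eq_mul, smul_eq_mul]
  field_simp

theorem meanCurvatureVector_eq_meanCurvature_smul (hm : m ≠ 0) (hT : LinearIndependent ℝ T.row)
    (hN : N ≠ 0) (hTN : T *ᵥ N = 0) {p : Fin m → ℝ}
    (hG : DifferentiableAt ℝ G (affineMap T b p)) (hG0 : G (affineMap T b p) ≠ 0) :
    meanCurvatureVector (conformalMetric G) (affineMap T b) p
      = meanCurvature (conformalMetric G) (affineMap T b)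
          (fun p => (G (affineMap T b p) / √(N ⬝ᵥ N)) • N) p
        • (G (affineMap T b p) / √(N ⬝ᵥ N)) • N := by
  have hNN : 0 < N ⬝ᵥ N := dotProduct_self_pos hN
  rw [meanCurvature_affineMap hm hT hN hTN hG hG0, smul_smul, div_mul_div_comm,
    Real.mul_self_sqrt hNN.le, meanCurvatureVector_affineMap_codim_one hm hT hN hTN hG hG0,
    mul_comm (G _)]

end Hypersurface

section NormalField

variable {m n : ℕ} {T : Matrix (Fin m) (Fin n) ℝ} {b N : Fin n → ℝ} {G : (Fin n → ℝ) → ℝ}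

theorem covDeriv_affineMap_smul_const {w : (Fin m → ℝ) → ℝ} {p : Fin m → ℝ}
    (hw : DifferentiableAt ℝ w p) (hG : DifferentiableAt ℝ G (affineMap T b p))
    (hG0 : G (affineMap T b p) ≠ 0) (v : Fin n → ℝ) (i : Fin m) :
    covDeriv (conformalMetric G) (affineMap T b) i (fun y => w y • v) p
      = grad w p i • v - (w p / G (affineMap T b p))
        • ((grad G (affineMap T b p) ⬝ᵥ T i) • v + (grad G (affineMap T b p) ⬝ᵥ v) • T i
          - (T i ⬝ᵥ v) • grad G (affineMap T b p)) := by
  rw [covDeriv_eq_fderiv_add _ _ _ (hw.smul_const v), fderiv_smul_const hw, dmap_affineMap,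
    christoffelForm_conformalMetric hG hG0, ContinuousLinearMap.smulRight_apply, dotProduct_smul,
    dotProduct_smul, smul_eq_mul, smul_eq_mul]
  change grad w p i • v + _ = _
  module

theorem covDeriv_sub (h : MetricField n) (φ : (Fin m → ℝ) → Fin n → ℝ) (i : Fin m)
    {V W : (Fin m → ℝ) → Fin n → ℝ} {p : Fin m → ℝ} (hV : DifferentiableAt ℝ V p)
    (hW : DifferentiableAt ℝ W p) :
    covDeriv h φ i (fun y => V y - W y) p = covDeriv h φ i V p - covDeriv h φ i W p := by
  rw [covDeriv_eq_fderiv_add _ _ _ hV, covDeriv_eq_fderiv_add _ _ _ hW,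
    covDeriv_eq_fderiv_add _ _ _ (hV.fun_sub hW), fderiv_fun_sub hV hW]
  ext k
  simp only [christoffelForm, sub_apply, Pi.add_apply, Pi.sub_apply, mul_sub,
    Finset.sum_sub_distrib]
  ring

theorem covDeriv_affineMap_normal (hTN : T *ᵥ N = 0) {u : (Fin m → ℝ) → ℝ} {p : Fin m → ℝ}
    (hu : DifferentiableAt ℝ u p) (hG : DifferentiableAt ℝ G (affineMap T b p))
    (hG0 : G (affineMap T b p) ≠ 0) (i : Fin m) :
    covDeriv (conformalMetric G) (affineMap T b) i (fun y => (G (affineMap T b y) * u y) • N) p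
      = (G (affineMap T b p) * grad u p i) • N
        - (u p * (grad G (affineMap T b p) ⬝ᵥ N)) • T i := by
  have hGφ : DifferentiableAt ℝ (fun y => G (affineMap T b y)) p :=
    (hG.comp p (hasFDerivAt_affineMap T b p).differentiableAt :)
  have hgrad : grad (fun y => G (affineMap T b y) * u y) p i
      = G (affineMap T b p) * grad u p i + u p * (grad G (affineMap T b p) ⬝ᵥ T i) := by
    rw [dotProduct_comm]
    change _ = _ + u p * (T *ᵥ grad G (affineMap T b p)) i
    rw [← grad_comp_affineMap hG]
    exact congrArg (· (Pi.single i 1)) (fderiv_fun_mul hGφ hu)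
  have hTi : T i ⬝ᵥ N = 0 := congrFun hTN i
  rw [covDeriv_affineMap_smul_const (hGφ.fun_mul hu) hG hG0, hgrad, hTi]
  ext k
  simp only [Pi.smul_apply, Pi.sub_apply, Pi.add_apply, smul_eq_mul]
  field_simp
  ring

theorem covDeriv_covDeriv_affineMap_normal (hTN : T *ᵥ N = 0) {u : (Fin m → ℝ) → ℝ}
    (hu : ContDiff ℝ 2 u) (hG : ContDiff ℝ 2 G) (hG0 : ∀ q, G q ≠ 0) (i j : Fin m)
    (p : Fin m → ℝ) :
    covDeriv (conformalMetric G) (affineMap T b) i (covDeriv (conformalMetric G) (affineMap T b) j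
        fun y => (G (affineMap T b y) * u y) • N) p
      = G (affineMap T b p) • hess u p i j • N
        - (grad G (affineMap T b p) ⬝ᵥ N) • (grad u p i • T j + grad u p j • T i)
        - u p • ((hess G (affineMap T b p) *ᵥ N ⬝ᵥ T i) • T j)
        + (u p * (grad G (affineMap T b p) ⬝ᵥ N) / G (affineMap T b p))
          • ((grad G (affineMap T b p) ⬝ᵥ T i) • T j + (grad G (affineMap T b p) ⬝ᵥ T j) • T i
            - (T i ⬝ᵥ T j) • grad G (affineMap T b p)) := by
  have hGd : Differentiable ℝ G := hG.differentiable two_ne_zero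
  have hud : Differentiable ℝ u := hu.differentiable two_ne_zero
  have huj : DifferentiableAt ℝ (fun y => grad u y j) p := differentiableAt_pi.1
    ((contDiff_grad (k := 1) hu (by norm_num)).differentiable one_ne_zero p) j
  have hGφ : DifferentiableAt ℝ (fun y => G (affineMap T b y)) p :=
    ((hGd _).comp p (hasFDerivAt_affineMap T b p).differentiableAt :)
  set ν : (Fin m → ℝ) → ℝ := fun y => grad G (affineMap T b y) ⬝ᵥ N
  have hνd : DifferentiableAt ℝ ν p :=
    ((differentiable_grad_dotProduct hG N _).comp p
      (hasFDerivAt_affineMap T b p).differentiableAt :)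
  have hgrad_ν : grad ν p i = hess G (affineMap T b p) *ᵥ N ⬝ᵥ T i := by
    rw [grad_comp_affineMap (u := fun q => grad G q ⬝ᵥ N) (differentiable_grad_dotProduct hG N _),
      grad_grad_dotProduct hG, dotProduct_comm]
    rfl
  have hgrad_uν : grad (fun y => u y * ν y) p i
      = u p * (hess G (affineMap T b p) *ᵥ N ⬝ᵥ T i) + ν p * grad u p i := by
    rw [← hgrad_ν]
    exact congrArg (· (Pi.single i 1)) (fderiv_fun_mul (hud p) hνd)
  have hfun : (covDeriv (conformalMetric G) (affineMap T b) j
      fun y => (G (affineMap T b y) * u y) • N)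
      = fun y => (G (affineMap T b y) * grad u y j) • N - (u y * ν y) • T j :=
    funext fun y => covDeriv_affineMap_normal hTN (hud y) (hGd _) (hG0 _) j
  rw [hfun, covDeriv_sub, covDeriv_affineMap_normal hTN huj (hGd _) (hG0 _),
    covDeriv_affineMap_smul_const ((hud p).fun_mul hνd) (hGd _) (hG0 _), hgrad_uν]
  · change (G _ * hess u p i j) • N - _ - _ = _
    module
  · exact (hGφ.fun_mul huj).smul_const N
  · exact ((hud p).fun_mul hνd).smul_const (T j)

end NormalField

section JacobiOperator

variable {m n : ℕ}

/-- The Jacobi operator `V ↦ Trace_g (∇^φ ∇^φ - ∇^φ_{∇^M}) V - Trace_g R^N(dφ, V) dφ` of a map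
`φ : (ℝᵐ, g) → (ℝⁿ, h)`, acting on vector fields along `φ`. -/
def jacobiOperator (g : MetricField m) (h : MetricField n) (φ : (Fin m → ℝ) → Fin n → ℝ)
    (V : (Fin m → ℝ) → Fin n → ℝ) (x : Fin m → ℝ) : Fin n → ℝ :=
  (∑ i, ∑ j, (g x)⁻¹ i j • (covDeriv h φ i (covDeriv h φ j V) x
      - ∑ k, christoffel g k i j x • covDeriv h φ k V x))
    - ∑ i, ∑ j, (g x)⁻¹ i j • curvatureOp h (φ x) (dmap φ i x) (V x) (dmap φ j x)

theorem bitension_eq_jacobiOperator_tension (g : MetricField m) (h : MetricField n)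
    (φ : (Fin m → ℝ) → Fin n → ℝ) : bitension g h φ = jacobiOperator g h φ (tension g h φ) :=
  rfl

variable {T : Matrix (Fin m) (Fin n) ℝ} {b N : Fin n → ℝ} {G : (Fin n → ℝ) → ℝ}

theorem gramTrace_covDeriv_covDeriv_affineMap_normal (hT : LinearIndependent ℝ T.row)
    (hTN : T *ᵥ N = 0) {u : (Fin m → ℝ) → ℝ} (hu : ContDiff ℝ 2 u) (hG : ContDiff ℝ 2 G)
    (hG0 : ∀ q, G q ≠ 0) (p : Fin m → ℝ) :
    gramTrace T (fun i j => covDeriv (conformalMetric G) (affineMap T b) i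
        (covDeriv (conformalMetric G) (affineMap T b) j
          fun y => (G (affineMap T b y) * u y) • N) p)
      = (G (affineMap T b p) * gramTrace T (hess u p)) • N
        - (2 * (grad G (affineMap T b p) ⬝ᵥ N)) • ((T * Tᵀ)⁻¹ *ᵥ grad u p) ᵥ* T
        - u p • rowProj T *ᵥ hess G (affineMap T b p) *ᵥ N
        + (u p * (grad G (affineMap T b p) ⬝ᵥ N) / G (affineMap T b p))
          • ((2 : ℝ) • rowProj T *ᵥ grad G (affineMap T b p)
            - (m : ℝ) • grad G (affineMap T b p)) := by
  have hswap (w : Fin m → ℝ) :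
      gramTrace T (fun i j => w i • T j) = gramTrace T (fun i j => w j • T i) :=
    gramTrace_swap T fun i j => w j • T i
  have hswap' (v : Fin n → ℝ) :
      gramTrace T (fun i j => (v ⬝ᵥ T i) • T j) = rowProj T *ᵥ v :=
    (hswap _).trans (gramTrace_dotProduct_smul_row T v)
  have htrace_hess : gramTrace T (fun i j => hess u p i j • N) = gramTrace T (hess u p) • N :=
    gramTrace_smul_const T (hess u p) N
  simp only [covDeriv_covDeriv_affineMap_normal hTN hu hG hG0, gramTrace_add, gramTrace_sub,
    gramTrace_smul, gramTrace_smul_const, htrace_hess, gramTrace_row_dotProduct_row hT, hswap',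
    gramTrace_dotProduct_smul_row, hswap (grad u p), gramTrace_smul_row T (grad u p)]
  module

theorem gramTrace_curvatureOp_normal (hT : LinearIndependent ℝ T.row) (hTN : T *ᵥ N = 0)
    (hG : ContDiff ℝ 2 G) (hG0 : ∀ q, G q ≠ 0) (q : Fin n → ℝ) (c : ℝ) :
    gramTrace T (fun i j => curvatureOp (conformalMetric G) q (T i) (c • N) (T j))
      = (c / G q) • (rowProj T *ᵥ hess G q *ᵥ N - (rowProj T * hess G q).trace • N
        - (m : ℝ) • (hess G q *ᵥ N - ((grad G q ⬝ᵥ grad G q) / G q) • N)) := by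
  have hTN' (j : Fin m) : N ⬝ᵥ T j = 0 := (dotProduct_comm _ _).trans (congrFun hTN j)
  have hR (i j : Fin m) : curvatureOp (conformalMetric G) q (T i) (c • N) (T j)
      = (c / G q) • (((hess G q *ᵥ N) ⬝ᵥ T j) • T i - (T j ⬝ᵥ hess G q *ᵥ T i) • N
        - (T i ⬝ᵥ T j) • (hess G q *ᵥ N - ((grad G q ⬝ᵥ grad G q) / G q) • N)) := by
    rw [curvatureOp_conformalMetric hG hG0, Matrix.mulVec_smul, dotProduct_smul, smul_dotProduct,
      hTN', dotProduct_comm (hess G q *ᵥ N)]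
    have := hG0 q
    ext k
    simp only [Pi.smul_apply, Pi.sub_apply, Pi.add_apply, smul_eq_mul]
    field_simp
    ring
  simp only [hR, gramTrace_sub, gramTrace_smul, gramTrace_smul_const,
    gramTrace_row_dotProduct_row hT, gramTrace_dotProduct_smul_row,
    gramTrace_row_dotProduct_mulVec]

/-- The second order operator `Trace B + B(N, N) / |N|²` with `B = G Hess G - 2 dG ⊗ dG`, through
which the ambient geometry enters the Jacobi operator of a hyperplane with normal vector `N`. -/
def hyperplaneOperator (N : Fin n → ℝ) (G : (Fin n → ℝ) → ℝ) (q : Fin n → ℝ) : ℝ :=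
  G q * (hess G q).trace - 2 * (grad G q ⬝ᵥ grad G q)
    + (G q * (N ⬝ᵥ hess G q *ᵥ N) - 2 * (grad G q ⬝ᵥ N) ^ 2) / (N ⬝ᵥ N)

end JacobiOperator

section ConformalSurface

variable {T : Matrix (Fin 2) (Fin 3) ℝ} {b N : Fin 3 → ℝ} {G : (Fin 3 → ℝ) → ℝ}

theorem tension_affineMap_two (hT : LinearIndependent ℝ T.row) (hN : N ≠ 0)
    (hTN : T *ᵥ N = 0) {ρ : (Fin 2 → ℝ) → ℝ} {p : Fin 2 → ℝ}
    (hG : DifferentiableAt ℝ G (affineMap T b p)) (hG0 : G (affineMap T b p) ≠ 0)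
    (hρ : DifferentiableAt ℝ ρ p) (hρ0 : ρ p ≠ 0) :
    tension (rescale ρ fun _ => T * Tᵀ) (conformalMetric G) (affineMap T b) p
      = (2 * (grad G (affineMap T b p) ⬝ᵥ N) / (ρ p * G (affineMap T b p) * (N ⬝ᵥ N))) • N := by
  rw [tension_affineMap hT hG hG0 hρ hρ0, rowProj_mulVec_eq_sub hT hN hTN, Nat.cast_ofNat,
    sub_self, zero_div, zero_smul, sub_zero, ← smul_sub, sub_sub_cancel, smul_smul, smul_smul,
    smul_smul]
  congr 1
  field_simp

theorem jacobiOperator_affineMap_normal (hT : LinearIndependent ℝ T.row) (hN : N ≠ 0)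
    (hTN : T *ᵥ N = 0) {u ρ : (Fin 2 → ℝ) → ℝ} (hu : ContDiff ℝ 2 u) (hG : ContDiff ℝ 2 G)
    (hG0 : ∀ q, G q ≠ 0) {p : Fin 2 → ℝ} (hρ : DifferentiableAt ℝ ρ p) (hρ0 : ρ p ≠ 0) :
    jacobiOperator (rescale ρ fun _ => T * Tᵀ) (conformalMetric G) (affineMap T b)
        (fun y => (G (affineMap T b y) * u y) • N) p
      = (ρ p)⁻¹ • ((G (affineMap T b p) * gramTrace T (hess u p)
            + u p / G (affineMap T b p) * hyperplaneOperator N G (affineMap T b p)) • N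
          + (-(2 * (grad G (affineMap T b p) ⬝ᵥ N)) • (T * Tᵀ)⁻¹ *ᵥ grad u p) ᵥ* T) := by
  have hsecond := (sum_inv_rescale_const_smul_sub_christoffel (isUnit_det_mul_transpose hT)
    (isSymm_mul_transpose T) hρ hρ0 (fun i j => covDeriv (conformalMetric G) (affineMap T b) i
      (covDeriv (conformalMetric G) (affineMap T b) j fun y => (G (affineMap T b y) * u y) • N) p)
    fun k => covDeriv (conformalMetric G) (affineMap T b) k
      (fun y => (G (affineMap T b y) * u y) • N) p)
  have hcurvature : ∑ i, ∑ j, (rescale ρ (fun _ => T * Tᵀ) p)⁻¹ i j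
        • curvatureOp (conformalMetric G) (affineMap T b p) (dmap (affineMap T b) i p)
          ((G (affineMap T b p) * u p) • N) (dmap (affineMap T b) j p)
      = (ρ p)⁻¹ • gramTrace T fun i j => curvatureOp (conformalMetric G) (affineMap T b p) (T i)
          ((G (affineMap T b p) * u p) • N) (T j) := by
    simp only [inv_rescale_const (isUnit_det_mul_transpose hT) hρ0, dmap_affineMap, gramTrace,
      Finset.smul_sum, Matrix.smul_apply, smul_assoc]
  rw [Nat.cast_ofNat, sub_self, zero_div, zero_smul, sub_zero] at hsecond
  rw [jacobiOperator, hsecond, hcurvature]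
  change (ρ p)⁻¹ • gramTrace T _ - _ = _
  rw [gramTrace_covDeriv_covDeriv_affineMap_normal hT hTN hu hG hG0,
    gramTrace_curvatureOp_normal hT hTN hG hG0, rowProj_mulVec_eq_sub hT hN hTN,
    rowProj_mulVec_eq_sub hT hN hTN, trace_rowProj_mul hT hN hTN, ← smul_sub]
  congr 1
  have := hG0 (affineMap T b p)
  have hNN := (dotProduct_self_pos hN).ne'
  ext k
  simp only [hyperplaneOperator, dotProduct_comm N (hess _ _ *ᵥ N), Matrix.smul_vecMul,
    Pi.smul_apply, Pi.sub_apply, Pi.add_apply, smul_eq_mul, Nat.cast_ofNat]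
  field_simp
  ring

/-- The function `u` in the expression `τ(φ) = G u N` of the tension field of the parametrized plane
`φ = affineMap T b` with normal vector `N`, for the metrics `ρ T Tᵀ` and `conformalMetric G`. -/
def tensionFactor (T : Matrix (Fin 2) (Fin 3) ℝ) (b N : Fin 3 → ℝ) (G : (Fin 3 → ℝ) → ℝ)
    (ρ : (Fin 2 → ℝ) → ℝ) (p : Fin 2 → ℝ) : ℝ :=
  2 * (grad G (affineMap T b p) ⬝ᵥ N) / (ρ p * G (affineMap T b p) ^ 2 * (N ⬝ᵥ N))

variable {ρ : (Fin 2 → ℝ) → ℝ}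

theorem contDiff_tensionFactor {k : WithTop ℕ∞} (hN : N ≠ 0) (hG : ContDiff ℝ (k + 1) G)
    (hG0 : ∀ q, G q ≠ 0) (hρ : ContDiff ℝ k ρ) (hρ0 : ∀ p, ρ p ≠ 0) :
    ContDiff ℝ k (tensionFactor T b N G ρ) := by
  have hφ : ContDiff ℝ k (affineMap T b) := contDiff_affineMap T b
  have hgrad : ContDiff ℝ k fun q => grad G q ⬝ᵥ N :=
    ContDiff.sum fun i _ => (contDiff_pi.1 (contDiff_grad hG le_rfl) i).mul contDiff_const
  have hGφ : ContDiff ℝ k fun p => G (affineMap T b p) := (hG.of_le le_self_add).comp hφ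
  exact (contDiff_const.mul (hgrad.comp hφ)).div ((hρ.mul (hGφ.pow 2)).mul contDiff_const)
    fun p => mul_ne_zero (mul_ne_zero (hρ0 p) (pow_ne_zero 2 (hG0 _))) (dotProduct_self_pos hN).ne'

theorem tension_eq_tensionFactor_smul (hT : LinearIndependent ℝ T.row) (hN : N ≠ 0)
    (hTN : T *ᵥ N = 0) (hG : Differentiable ℝ G) (hG0 : ∀ q, G q ≠ 0) (hρ : Differentiable ℝ ρ)
    (hρ0 : ∀ p, ρ p ≠ 0) :
    tension (rescale ρ fun _ => T * Tᵀ) (conformalMetric G) (affineMap T b)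
      = fun p => (G (affineMap T b p) * tensionFactor T b N G ρ p) • N := by
  ext1 p
  rw [tension_affineMap_two hT hN hTN (hG _) (hG0 _) (hρ p) (hρ0 p), tensionFactor]
  have := hG0 (affineMap T b p)
  congr 1
  field_simp

theorem isHarmonicMap_affineMap_iff (hT : LinearIndependent ℝ T.row) (hN : N ≠ 0)
    (hTN : T *ᵥ N = 0) (hG : Differentiable ℝ G) (hG0 : ∀ q, G q ≠ 0) (hρ : Differentiable ℝ ρ)
    (hρ0 : ∀ p, ρ p ≠ 0) :
    IsHarmonicMap (rescale ρ fun _ => T * Tᵀ) (conformalMetric G) (affineMap T b)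
      ↔ ∀ p, tensionFactor T b N G ρ p = 0 := by
  simp only [IsHarmonicMap, tension_eq_tensionFactor_smul hT hN hTN hG hG0 hρ hρ0, smul_eq_zero,
    mul_eq_zero, hG0, hN, false_or, or_false]

/-- The two conditions are the normal and the tangential part of the biharmonic equation. -/
theorem isBiharmonicMap_affineMap_iff (hT : LinearIndependent ℝ T.row) (hN : N ≠ 0)
    (hTN : T *ᵥ N = 0) (hG : ContDiff ℝ 3 G) (hG0 : ∀ q, G q ≠ 0) (hρ : ContDiff ℝ 2 ρ)
    (hρ0 : ∀ p, ρ p ≠ 0) :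
    IsBiharmonicMap (rescale ρ fun _ => T * Tᵀ) (conformalMetric G) (affineMap T b)
      ↔ ∀ p, G (affineMap T b p) * gramTrace T (hess (tensionFactor T b N G ρ) p)
            + tensionFactor T b N G ρ p / G (affineMap T b p)
              * hyperplaneOperator N G (affineMap T b p) = 0
          ∧ tensionFactor T b N G ρ p • grad (tensionFactor T b N G ρ) p = 0 := by
  have hG1 : Differentiable ℝ G := hG.differentiable three_ne_zero
  have hρ1 : Differentiable ℝ ρ := hρ.differentiable two_ne_zero
  have hu : ContDiff ℝ 2 (tensionFactor T b N G ρ) :=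
    contDiff_tensionFactor hN (by exact_mod_cast hG) hG0 hρ hρ0
  have hinj : Function.Injective (T * Tᵀ)⁻¹.mulVec :=
    Matrix.mulVec_injective_iff_isUnit.2 (posDef_mul_transpose hT).inv.isUnit
  have htangential (p : Fin 2 → ℝ) (w : Fin 2 → ℝ) :
      -(2 * (grad G (affineMap T b p) ⬝ᵥ N)) • (T * Tᵀ)⁻¹ *ᵥ w = 0
        ↔ tensionFactor T b N G ρ p • w = 0 := by
    have hw : (T * Tᵀ)⁻¹ *ᵥ w = 0 ↔ w = 0 := hinj.eq_iff' (Matrix.mulVec_zero _)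
    have hν : tensionFactor T b N G ρ p = 0 ↔ grad G (affineMap T b p) ⬝ᵥ N = 0 := by
      simp [tensionFactor, hG0, hρ0, hN]
    rw [smul_eq_zero, smul_eq_zero, hw, hν, neg_eq_zero, mul_eq_zero_iff_left two_ne_zero]
  refine forall_congr' fun p => ?_
  rw [bitension_eq_jacobiOperator_tension,
    tension_eq_tensionFactor_smul hT hN hTN hG1 hG0 hρ1 hρ0,
    jacobiOperator_affineMap_normal hT hN hTN hu (hG.of_le (by norm_num)) hG0 (hρ1 p) (hρ0 p),
    smul_eq_zero_iff_right (inv_ne_zero (hρ0 p)), smul_normal_add_vecMul_eq_zero hT hN hTN,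
    htangential]

theorem isProperBiharmonicMap_affineMap_iff (hT : LinearIndependent ℝ T.row) (hN : N ≠ 0)
    (hTN : T *ᵥ N = 0) (hG : ContDiff ℝ 3 G) (hG0 : ∀ q, G q ≠ 0) (hρ : ContDiff ℝ 2 ρ)
    (hρ0 : ∀ p, ρ p ≠ 0) :
    IsProperBiharmonicMap (rescale ρ fun _ => T * Tᵀ) (conformalMetric G) (affineMap T b)
      ↔ (∀ p, hyperplaneOperator N G (affineMap T b p) = 0)
        ∧ ∃ c, 0 < c ∧ ∀ p, |tensionFactor T b N G ρ p| = c := by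
  set u := tensionFactor T b N G ρ with hu_def
  have hu : Differentiable ℝ u := (contDiff_tensionFactor hN (by exact_mod_cast hG) hG0 hρ
    hρ0).differentiable two_ne_zero
  have normal_part {c : ℝ} (hc : 0 < c) (hcu : ∀ p, |u p| = c) (p : Fin 2 → ℝ) :
      G (affineMap T b p) * gramTrace T (hess u p)
          + u p / G (affineMap T b p) * hyperplaneOperator N G (affineMap T b p) = 0
        ↔ hyperplaneOperator N G (affineMap T b p) = 0 := by
    have hu0 (p : Fin 2 → ℝ) : u p ≠ 0 := abs_pos.1 ((hcu p).symm ▸ hc)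
    have hgrad (p : Fin 2 → ℝ) : grad u p = 0 :=
      (smul_eq_zero_iff_right (hu0 p)).1 ((forall_smul_grad_eq_zero_iff hu).2 ⟨c, hcu⟩ p)
    simp [hess_eq_zero hgrad, gramTrace, hu0, hG0]
  rw [IsProperBiharmonicMap, isBiharmonicMap_affineMap_iff hT hN hTN hG hG0 hρ hρ0,
    isHarmonicMap_affineMap_iff hT hN hTN (hG.differentiable three_ne_zero) hG0
      (hρ.differentiable two_ne_zero) hρ0, forall_and, forall_smul_grad_eq_zero_iff hu, ← hu_def]
  constructor
  · rintro ⟨⟨hnormal, c, hcu⟩, hharm⟩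
    obtain ⟨p, hp⟩ := not_forall.1 hharm
    have hc : 0 < c := hcu p ▸ abs_pos.2 hp
    exact ⟨fun p => (normal_part hc hcu p).1 (hnormal p), c, hc, hcu⟩
  · rintro ⟨hQ, c, hc, hcu⟩
    refine ⟨⟨fun p => (normal_part hc hcu p).2 (hQ p), c, hcu⟩, fun hharm => ?_⟩
    exact hc.ne' (by rw [← hcu 0, hharm, abs_zero])

end ConformalSurface

section RescaledPullback

theorem exists_abs_two_mul_mul_div_sq_eq_iff {ι : Type*} {f ν : ι → ℝ} {s : ℝ} (hs : 0 < s)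
    (hf : ∀ p, 0 < f p) :
    (∃ c, 0 < c ∧ ∀ p, |2 * f p * ν p / s ^ 2| = c)
      ↔ ∃ c, 0 < c ∧ ∀ p, ν p ≠ 0 ∧ f p = c * s / |ν p| := by
  have habs (p : ι) : |2 * f p * ν p / s ^ 2| = 2 * f p * |ν p| / s ^ 2 := by
    rw [abs_div, abs_mul, abs_mul, abs_two, abs_of_pos (hf p), abs_of_pos (pow_pos hs 2)]
  simp only [habs]
  constructor
  · rintro ⟨c, hc, h⟩
    refine ⟨c * s / 2, by positivity, fun p => ?_⟩
    have hν : ν p ≠ 0 := fun hν => hc.ne (by simp [← h p, hν])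
    refine ⟨hν, ?_⟩
    rw [← h p]
    field_simp
  · rintro ⟨c, hc, h⟩
    refine ⟨2 * c / s, by positivity, fun p => ?_⟩
    obtain ⟨hν, hfp⟩ := h p
    rw [hfp]
    field_simp

variable {T : Matrix (Fin 2) (Fin 3) ℝ} {b N : Fin 3 → ℝ} {G : (Fin 3 → ℝ) → ℝ}
  {f : (Fin 2 → ℝ) → ℝ}

theorem tensionFactor_inv_mul_inv_sq (hG0 : ∀ q, G q ≠ 0) (p : Fin 2 → ℝ) :
    tensionFactor T b N G (fun p => (f p)⁻¹ * (G (affineMap T b p) ^ 2)⁻¹) p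
      = 2 * f p * (grad G (affineMap T b p) ⬝ᵥ N) / √(N ⬝ᵥ N) ^ 2 := by
  have hNN : 0 ≤ N ⬝ᵥ N := by simpa using dotProduct_star_self_nonneg N
  rw [tensionFactor, inv_mul_cancel_right₀ (pow_ne_zero 2 (hG0 _)), Real.sq_sqrt hNN,
    div_mul_eq_div_div, div_inv_eq_mul, mul_right_comm]

theorem isProperBiharmonicMap_rescale_pullback_iff (hT : LinearIndependent ℝ T.row) (hN : N ≠ 0)
    (hTN : T *ᵥ N = 0) (hG : ContDiff ℝ 3 G) (hG0 : ∀ q, G q ≠ 0) (hf : ContDiff ℝ 2 f)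
    (hf_pos : ∀ p, 0 < f p) :
    IsProperBiharmonicMap
        (rescale (fun p => (f p)⁻¹) (pullback (affineMap T b) (conformalMetric G)))
        (conformalMetric G) (affineMap T b)
      ↔ (∀ p, hyperplaneOperator N G (affineMap T b p) = 0)
        ∧ ∃ c, 0 < c ∧ ∀ p, grad G (affineMap T b p) ⬝ᵥ N ≠ 0
          ∧ f p = c * √(N ⬝ᵥ N) / |grad G (affineMap T b p) ⬝ᵥ N| := by
  have hf0 (p : Fin 2 → ℝ) : f p ≠ 0 := (hf_pos p).ne'
  have hGφ : ContDiff ℝ 2 fun p => G (affineMap T b p) :=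
    (hG.of_le (by norm_num)).comp (contDiff_affineMap T b)
  have hGφ0 (p : Fin 2 → ℝ) : G (affineMap T b p) ^ 2 ≠ 0 := pow_ne_zero 2 (hG0 _)
  have hρ : ContDiff ℝ 2 fun p => (f p)⁻¹ * (G (affineMap T b p) ^ 2)⁻¹ :=
    (hf.inv hf0).mul ((hGφ.pow 2).inv hGφ0)
  rw [pullback_affineMap, rescale_rescale,
    isProperBiharmonicMap_affineMap_iff hT hN hTN hG hG0 hρ fun p =>
      mul_ne_zero (inv_ne_zero (hf0 p)) (inv_ne_zero (hGφ0 p)),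
    ← exists_abs_two_mul_mul_div_sq_eq_iff (Real.sqrt_pos.2 (dotProduct_self_pos hN)) hf_pos]
  simp only [tensionFactor_inv_mul_inv_sq hG0]

end RescaledPullback

section Plane

/-- The matrix whose rows are the coordinate vector fields of the plane `planeMap a₁ a₂ a₃`. -/
def planeTangent (a₁ a₂ : ℝ) : Matrix (Fin 2) (Fin 3) ℝ :=
  !![1, 0, a₁; 0, 1, a₂]

/-- The Euclidean normal vector of the plane `planeMap a₁ a₂ a₃` with last coordinate `1`. -/
def planeNormal (a₁ a₂ : ℝ) : Fin 3 → ℝ :=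
  ![-a₁, -a₂, 1]

variable (a₁ a₂ : ℝ)

theorem planeMap_eq_affineMap (a₃ : ℝ) :
    planeMap a₁ a₂ a₃ = affineMap (planeTangent a₁ a₂) ![0, 0, a₃] := by
  ext p k
  fin_cases k <;>
    simp [planeMap, affineMap, planeTangent, Matrix.vecHead, Matrix.vecTail, mul_comm]

theorem linearIndependent_planeTangent : LinearIndependent ℝ (planeTangent a₁ a₂).row := by
  refine LinearIndependent.pair_iff.2 fun s t h => ⟨?_, ?_⟩
  · simpa [planeTangent] using congrFun h 0
  · simpa [planeTangent] using congrFun h 1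

theorem planeNormal_ne_zero : planeNormal a₁ a₂ ≠ 0 := fun h => by
  simpa [planeNormal] using congrFun h 2

theorem planeTangent_mulVec_planeNormal : planeTangent a₁ a₂ *ᵥ planeNormal a₁ a₂ = 0 := by
  ext i
  fin_cases i <;> simp [planeTangent, planeNormal]

theorem planeNormal_dotProduct_self :
    planeNormal a₁ a₂ ⬝ᵥ planeNormal a₁ a₂ = 1 + a₁ ^ 2 + a₂ ^ 2 := by
  simp [planeNormal, dotProduct, Fin.sum_univ_three]
  ring

theorem grad_dotProduct_planeNormal (G : (Fin 3 → ℝ) → ℝ) (q : Fin 3 → ℝ) :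
    grad G q ⬝ᵥ planeNormal a₁ a₂ = normalDeriv a₁ a₂ G q := by
  simp [planeNormal, normalDeriv, grad, dotProduct, Fin.sum_univ_three]
  ring

theorem hyperplaneOperator_planeNormal {G : (Fin 3 → ℝ) → ℝ} (hG : ContDiff ℝ 2 G)
    (q : Fin 3 → ℝ) : hyperplaneOperator (planeNormal a₁ a₂) G q = planeOperator a₁ a₂ G q := by
  have hsymm (i j : Fin 3) : pd i (pd j G) q = pd j (pd i G) q := (isSymm_hess hG q).apply j i
  have : 1 + a₁ ^ 2 + a₂ ^ 2 ≠ 0 := by positivity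
  rw [hyperplaneOperator, planeNormal_dotProduct_self, grad_dotProduct_planeNormal]
  simp [planeOperator, normalDeriv, planeNormal, Matrix.trace, Matrix.mulVec, grad, hess,
    dotProduct, Fin.sum_univ_three, hsymm 0 1, hsymm 0 2, hsymm 1 2]
  field_simp
  ring

end Plane

end

end CoordGeom

open CoordGeom Matrix in
theorem mainTheorem4_general (T : Matrix (Fin 2) (Fin 3) ℝ) (b N : Fin 3 → ℝ)
    (hT : LinearIndependent ℝ T.row) (hN : N ≠ 0) (hTN : T *ᵥ N = 0) (G : (Fin 3 → ℝ) → ℝ)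
    (f : (Fin 2 → ℝ) → ℝ) (hG : ContDiff ℝ ∞ G) (hG0 : ∀ q, G q ≠ 0) (hf : ContDiff ℝ ∞ f)
    (hf_pos : ∀ p, 0 < f p)
    (φ : (Fin 2 → ℝ) → Fin 3 → ℝ) (hφ : φ = affineMap T b)
    (h : MetricField 3) (hh : h = conformalMetric G)
    (g : MetricField 2) (hg : g = rescale (fun p => (f p)⁻¹) (pullback φ h))
    (ξ : (Fin 2 → ℝ) → Fin 3 → ℝ) (hξ : ξ = fun p => (G (φ p) / √(N ⬝ᵥ N)) • N) :
    (IsProperBiharmonicMap g h φ ↔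
      (∀ p, hyperplaneOperator N G (φ p) = 0) ∧
      ∃ c : ℝ, 0 < c ∧ ∀ p, grad G (φ p) ⬝ᵥ N ≠ 0 ∧
        f p = c * √(N ⬝ᵥ N) / |grad G (φ p) ⬝ᵥ N|) ∧
    IsConformalImmersion g h φ (fun p => √(f p)) ∧
    IsUnitNormal h φ ξ ∧
    (∀ p, meanCurvature h φ ξ p = (grad G (φ p) ⬝ᵥ N) / √(N ⬝ᵥ N)) ∧
    (∀ p, meanCurvatureVector h φ p = meanCurvature h φ ξ p • ξ p) := by
  subst hφ hh hg hξ
  have hGd : Differentiable ℝ G := hG.differentiable (by simp)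
  exact ⟨isProperBiharmonicMap_rescale_pullback_iff hT hN hTN (contDiff_infty.1 hG 3) hG0
      (contDiff_infty.1 hf 2) hf_pos,
    isConformalImmersion_affineMap b hT hG hG0 hf hf_pos,
    isUnitNormal_affineMap hN hTN hG hG0,
    fun _ => meanCurvature_affineMap two_ne_zero hT hN hTN (hGd _) (hG0 _),
    fun _ => meanCurvatureVector_eq_meanCurvature_smul two_ne_zero hT hN hTN (hGd _) (hG0 _)⟩

theorem mainTheorem4 (a₁ a₂ a₃ : ℝ) (F β : (Fin 3 → ℝ) → ℝ) (f : (Fin 2 → ℝ) → ℝ)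
    (hF : ContDiff ℝ ∞ F) (hβ : ContDiff ℝ ∞ β) (hf : ContDiff ℝ ∞ f)
    (hF_pos : ∀ q, 0 < F q) (hβ_pos : ∀ q, 0 < β q) (hf_pos : ∀ p, 0 < f p)
    (φ : (Fin 2 → ℝ) → (Fin 3 → ℝ)) (hφ : φ = CoordGeom.planeMap a₁ a₂ a₃)
    (h₀ h : CoordGeom.MetricField 3)
    (hh₀ : h₀ = CoordGeom.rescale (fun q => (F q ^ 2)⁻¹) (CoordGeom.euclideanMetric 3))
    (hh : h = CoordGeom.rescale (fun q => (β q ^ 2)⁻¹) h₀)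
    (g : CoordGeom.MetricField 2)
    (hg : g = CoordGeom.rescale (fun p => (f p)⁻¹) (CoordGeom.pullback φ h))
    (G : (Fin 3 → ℝ) → ℝ) (hG : G = fun q => F q * β q)
    (ξ : (Fin 2 → ℝ) → (Fin 3 → ℝ))
    (hξ : ξ = fun p => (G (φ p) / √(1 + a₁ ^ 2 + a₂ ^ 2)) • ![-a₁, -a₂, 1]) :
    -- characterization of proper biharmonicity
    (CoordGeom.IsProperBiharmonicMap g h φ ↔
      (∀ p, CoordGeom.planeOperator a₁ a₂ G (φ p) = 0) ∧
      ∃ c : ℝ, 0 < c ∧ ∀ p, CoordGeom.normalDeriv a₁ a₂ G (φ p) ≠ 0 ∧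
        f p = c * √(1 + a₁ ^ 2 + a₂ ^ 2) / |CoordGeom.normalDeriv a₁ a₂ G (φ p)|) ∧
    -- the conformal factor
    CoordGeom.IsConformalImmersion g h φ (fun p => √(f p)) ∧
    -- the mean curvature of the surface
    CoordGeom.IsUnitNormal h φ ξ ∧
    (∀ p, CoordGeom.meanCurvature h φ ξ p =
      CoordGeom.normalDeriv a₁ a₂ G (φ p) / √(1 + a₁ ^ 2 + a₂ ^ 2)) ∧
    (∀ p, CoordGeom.meanCurvatureVector h φ p = CoordGeom.meanCurvature h φ ξ p • ξ p) := by
  have hG_smooth : ContDiff ℝ ∞ G := hG ▸ hF.mul hβ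
  have hG0 (q) : G q ≠ 0 := hG ▸ (mul_pos (hF_pos q) (hβ_pos q)).ne'
  rw [hh₀, CoordGeom.rescale_rescale_euclideanMetric, ← hG] at hh
  rw [CoordGeom.planeMap_eq_affineMap] at hφ
  have key := mainTheorem4_general _ _ _ (CoordGeom.linearIndependent_planeTangent a₁ a₂)
    (CoordGeom.planeNormal_ne_zero a₁ a₂) (CoordGeom.planeTangent_mulVec_planeNormal a₁ a₂) G f
    hG_smooth hG0 hf hf_pos φ hφ h hh g hg ξ
    (by rw [hξ, CoordGeom.planeNormal_dotProduct_self, CoordGeom.planeNormal])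
  simpa only [CoordGeom.planeNormal_dotProduct_self, CoordGeom.grad_dotProduct_planeNormal,
    CoordGeom.hyperplaneOperator_planeNormal a₁ a₂ (contDiff_infty.1 hG_smooth 2)] using key
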